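/- Let $(X,d)$ be a metric space. We use the following conditions. \emph{$\boxtimes$-inequalities:} for all $t,s\in[0,1]$ and all $x,y,z,w\in X$, $$0\le (1-t)(1-s)d(x,y)^2+t(1-s)d(y,z)^2+ts\,d(z,w)^2+(1-t)s\,d(w,x)^2-t(1-t)d(x,z)^2-s(1-s)d(y,w)^2 .$$ \emph{$\mathrm{Cycl}_n(0)$ (for an integer $n\ge 4$):} for every map $f:\mathbb Z/n\mathbb Z\to X$ there is a map $g:\mathbb Z/n\mathbb Z\to\mathbb R^2$ into the Euclidean plane such that $\|g(i)-g(i+1)\|\le d(f(i),f(i+1))$ for all $i$, and $\|g(i)-g(j)\|\ge d(f(i),f(j))$ for all $i,j\in\mathbb Z/n\mathbb Z$ with $j\ne i+1$ and $i\ne j+1$. \emph{$\mathrm{Wir}_n$ inequalities (for an integer $n\ge 4$):} for every map $f:\mathbb Z/n\mathbb Z\to X$ and every integer $j$ with $2\le j\le n-2$, $$0\le \sin^2\frac{j\pi}{n}\sum_{i\in\mathbb Z/n\mathbb Z}d(f(i),f(i+1))^2-\sin^2\frac{\pi}{n}\sum_{i\in\mathbb Z/n\mathbb Z}d(f(i),f(i+j))^2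 .$$ Corollary. If $X$ satisfies the $\boxtimes$-inequalities, then for every integer $n\ge 4$ the space $X$ is $\mathrm{Cycl}_n(0)$ and, in particular, satisfies the $\mathrm{Wir}_n$ inequalities. Moreover (Kondo--Toyoda--Uehara), every $\mathrm{Cycl}_4(0)$ metric space satisfies the $\mathrm{Wir}_n$ inequalities for every integer $n\ge 4$. -/

import Mathlib

/-- The `⊠`-inequalities (weighted quadruple inequalities) for a metric space `X`. -/
def SatisfiesBoxtimesInequalities (X : Type*) [MetricSpace X] : Prop :=
  ∀ t ∈ Set.Icc (0 : ℝ) 1, ∀ s ∈ Set.Icc (0 : ℝ) 1, ∀ x y z w : X,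
    0 ≤ (1 - t) * (1 - s) * dist x y ^ 2 + t * (1 - s) * dist y z ^ 2
      + t * s * dist z w ^ 2 + (1 - t) * s * dist w x ^ 2
      - t * (1 - t) * dist x z ^ 2 - s * (1 - s) * dist y w ^ 2

/-- The condition `Cycl_n(0)` (used for `n ≥ 4`). The model surface of curvature `0` is the
Euclidean plane, whose diameter is infinite, so no bound on the perimeter of the cycle is
imposed. -/
def IsCyclZero (n : ℕ) (X : Type*) [MetricSpace X] : Prop :=
  ∀ f : ZMod n → X, ∃ g : ZMod n → EuclideanSpace ℝ (Fin 2),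
    (∀ i : ZMod n, dist (g i) (g (i + 1)) ≤ dist (f i) (f (i + 1))) ∧
    (∀ i j : ZMod n, j ≠ i + 1 → i ≠ j + 1 → dist (f i) (f j) ≤ dist (g i) (g j))

/-- The `Wir_n` inequalities (used for `n ≥ 4`); `j` runs through the integers with
`2 ≤ j ≤ n - 2`. -/
def SatisfiesWirInequalities (n : ℕ) [NeZero n] (X : Type*) [MetricSpace X] : Prop :=
  ∀ f : ZMod n → X, ∀ j : ℕ, 2 ≤ j → j + 2 ≤ n →
    0 ≤ Real.sin (j * Real.pi / n) ^ 2 * ∑ i : ZMod n, dist (f i) (f (i + 1)) ^ 2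
      - Real.sin (Real.pi / n) ^ 2 * ∑ i : ZMod n, dist (f i) (f (i + (j : ZMod n))) ^ 2

/-! The space enters only through its squared distances `D`, which form a box form; this generality
lets the induction be applied to points of a cone.

Wir: the `⊠`-inequality for the quadrilaterals `i, i+1, i+j+1, i+j+2`, weighted so that it is an
equality on the regular `n`-gon and summed over `i`, relates consecutive chord sums. A discrete
maximum principle then compares these sums with `sin² (jπ/n)`. As `Cycl_4(0)` gives the
`⊠`-inequalities, the last claim follows too.

Cycl: induction on the number of vertices. Regard vertex `0` as the apex of a fan of triangles over
the chain of the others. Enlarge the distances from the apex until the chain is convex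
(`exists_convex_radii`), keeping its edges and the first and last radius. By `IsBoxForm.exists_fan`,
the fan, developed in the Euclidean cone over the line, does not decrease distances. If its total
angle is at most `π`, it is already a plane polygon. Otherwise the geodesic joining the ends of the
chain passes through the apex; the cone is itself a box form (`isBoxForm_coneSq`), so the induction
hypothesis majorizes the chain by a plane polygon, and the apex is put back on its closing edge.
Degenerate configurations are reached by perturbation and compactness. -/

/-- A symmetric function vanishing on the diagonal that satisfies the `⊠`-inequalities in the
place of the squared distance. -/
structure IsBoxForm {ι : Type*} (D : ι → ι → ℝ) : Prop where
  self : ∀ x, D x x = 0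
  symm : ∀ x y, D x y = D y x
  box : ∀ t ∈ Set.Icc (0 : ℝ) 1, ∀ s ∈ Set.Icc (0 : ℝ) 1, ∀ x y z w,
    0 ≤ (1 - t) * (1 - s) * D x y + t * (1 - s) * D y z
      + t * s * D z w + (1 - t) * s * D w x
      - t * (1 - t) * D x z - s * (1 - s) * D y w

/-! ### The `⊠`-inequalities and `Cycl_4(0)` -/

theorem SatisfiesBoxtimesInequalities.isBoxForm {X : Type*} [MetricSpace X]
    (h : SatisfiesBoxtimesInequalities X) {ι : Type*} (f : ι → X) :
    IsBoxForm fun i j => dist (f i) (f j) ^ 2 where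
  self x := by simp
  symm x y := by simp [dist_comm]
  box t ht s hs x y z w := h t ht s hs (f x) (f y) (f z) (f w)

/-- The right-hand side is the squared length of `(1-t)x + tz - (1-s)y - sw`. -/
theorem euclidean_box_nonneg (t s : ℝ) (x y z w : EuclideanSpace ℝ (Fin 2)) :
    0 ≤ (1 - t) * (1 - s) * dist x y ^ 2 + t * (1 - s) * dist y z ^ 2
      + t * s * dist z w ^ 2 + (1 - t) * s * dist w x ^ 2
      - t * (1 - t) * dist x z ^ 2 - s * (1 - s) * dist y w ^ 2 := by
  simp only [EuclideanSpace.dist_sq_eq, Fin.sum_univ_two, Real.dist_eq, sq_abs]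
  have h0 := sq_nonneg ((1 - t) * x 0 + t * z 0 - (1 - s) * y 0 - s * w 0)
  have h1 := sq_nonneg ((1 - t) * x 1 + t * z 1 - (1 - s) * y 1 - s * w 1)
  linarith

theorem IsCyclZero.satisfiesBoxtimesInequalities {X : Type*} [MetricSpace X]
    (h : IsCyclZero 4 X) : SatisfiesBoxtimesInequalities X := by
  intro t ht s hs x y z w
  obtain ⟨ht0, ht1⟩ := ht
  obtain ⟨hs0, hs1⟩ := hs
  obtain ⟨g, hg1, hg2⟩ := h (![x, y, z, w] : Fin 4 → X)
  have e0 : dist (g 0) (g 1) ≤ dist x y := hg1 0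
  have e1 : dist (g 1) (g 2) ≤ dist y z := hg1 1
  have e2 : dist (g 2) (g 3) ≤ dist z w := hg1 2
  have e3 : dist (g 3) (g 0) ≤ dist w x := hg1 3
  have d0 : dist x z ≤ dist (g 0) (g 2) := hg2 0 2 (by decide) (by decide)
  have d1 : dist y w ≤ dist (g 1) (g 3) := hg2 1 3 (by decide) (by decide)
  have key := euclidean_box_nonneg t s (g 0) (g 1) (g 2) (g 3)
  have ht1' : 0 ≤ 1 - t := by linarith
  have hs1' : 0 ≤ 1 - s := by linarith
  have a0 := mul_le_mul_of_nonneg_left (pow_le_pow_left₀ dist_nonneg e0 2)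
    (mul_nonneg ht1' hs1')
  have a1 := mul_le_mul_of_nonneg_left (pow_le_pow_left₀ dist_nonneg e1 2) (mul_nonneg ht0 hs1')
  have a2 := mul_le_mul_of_nonneg_left (pow_le_pow_left₀ dist_nonneg e2 2) (mul_nonneg ht0 hs0)
  have a3 := mul_le_mul_of_nonneg_left (pow_le_pow_left₀ dist_nonneg e3 2) (mul_nonneg ht1' hs0)
  have b0 := mul_le_mul_of_nonneg_left (pow_le_pow_left₀ dist_nonneg d0 2) (mul_nonneg ht0 ht1')
  have b1 := mul_le_mul_of_nonneg_left (pow_le_pow_left₀ dist_nonneg d1 2) (mul_nonneg hs0 hs1')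
  linarith

/-! ### The `Wir_n` inequalities -/

/-- A maximum principle: the ratio `a j / S j ^ 2` is at most its value at the ends. -/
theorem ratio_le_of_trapezoid {n : ℕ} (hn : 2 ≤ n) (a S : ℕ → ℝ)
    (hS : ∀ j, 1 ≤ j → j + 1 ≤ n → 0 < S j) (hend : a (n - 1) * S 1 ^ 2 = a 1 * S (n - 1) ^ 2)
    (hprod : ∀ j, S (j + 2) * S j = S (j + 1) ^ 2 - S 1 ^ 2)
    (htrap : ∀ j, 1 ≤ j → j + 3 ≤ n →
      2 * (S (j + 2) * S j) * a (j + 1) ≤ 2 * (S (j + 2) * S j) * a 1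
        + S (j + 2) ^ 2 * a j + S j ^ 2 * a (j + 2))
    (j : ℕ) (hj : 1 ≤ j) (hjn : j + 1 ≤ n) : a j * S 1 ^ 2 ≤ a 1 * S j ^ 2 := by
  obtain ⟨m, hm, hmax⟩ := Finset.exists_max_image (Finset.Icc 1 (n - 1))
    (fun j => a j / S j ^ 2) ⟨1, by simp; omega⟩
  rw [Finset.mem_Icc] at hm
  have hS1 : 0 < S 1 := hS 1 le_rfl (by omega)
  have key : a m / S m ^ 2 ≤ a 1 / S 1 ^ 2 := by
    by_cases h1 : m = 1
    · rw [h1]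
    by_cases h2 : m = n - 1
    · have := hS (n - 1) (by omega) (by omega)
      rw [h2, div_le_div_iff₀ (by positivity) (by positivity)]
      exact hend.le
    obtain ⟨k, rfl⟩ : ∃ k, m = k + 1 := ⟨m - 1, by omega⟩
    have s0 := hS k (by omega) (by omega)
    have s1 := hS (k + 1) (by omega) (by omega)
    have s2 := hS (k + 2) (by omega) (by omega)
    have h := htrap k (by omega) (by omega)
    have c0 := hmax k (by simp; omega)
    have c2 := hmax (k + 2) (by simp; omega)
    -- At an interior maximum `M`, replacing `a k` and `a (k + 2)` by `M * S k ^ 2` and `M * S (k +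
    -- 2) ^ 2` in `htrap`, then using `hprod`, leaves `M * S 1 ^ 2 ≤ a 1`.
    set M := a (k + 1) / S (k + 1) ^ 2 with hM
    have e1 : a (k + 1) = M * S (k + 1) ^ 2 := by rw [hM]; field_simp
    rw [div_le_iff₀ (by positivity)] at c0 c2
    rw [le_div_iff₀ (by positivity)]
    have p := hprod k
    have h0 := mul_le_mul_of_nonneg_left c0 (sq_nonneg (S (k + 2)))
    have h2 := mul_le_mul_of_nonneg_left c2 (sq_nonneg (S k))
    rw [e1] at h
    have pos : 0 < S (k + 2) * S k := by positivity
    have h3 : (S (k + 2) * S k) * (M * S (k + 1) ^ 2) ≤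
        (S (k + 2) * S k) * (a 1 + M * (S (k + 2) * S k)) := by nlinarith
    have h4 := le_of_mul_le_mul_left h3 pos
    rw [p] at h4
    linarith
  have hb := (hmax j (by simp; omega)).trans key
  have := hS j hj hjn
  rw [div_le_div_iff₀ (by positivity) (by positivity)] at hb
  exact hb

/-- The weights `p / (p + q)` and `q / (p + q)` locate the crossing of the diagonals of a trapezoid
with parallel sides `p` and `q`. Applied with the chords `sin ((j+2)π/n)` and `sin (jπ/n)` of the
regular `n`-gon, this loses nothing. -/
theorem sum_dist_sq_trapezoid {n : ℕ} [NeZero n] {X : Type*} [MetricSpace X]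
    (h : SatisfiesBoxtimesInequalities X) (f : ZMod n → X) (j : ZMod n) {p q : ℝ} (hp : 0 < p)
    (hq : 0 < q) :
    2 * (p * q) * ∑ i, dist (f i) (f (i + (j + 1))) ^ 2 ≤
      2 * (p * q) * ∑ i, dist (f i) (f (i + 1)) ^ 2
        + p ^ 2 * ∑ i, dist (f i) (f (i + j)) ^ 2
        + q ^ 2 * ∑ i, dist (f i) (f (i + (j + 2))) ^ 2 := by
  have hpq : 0 < p + q := by positivity
  have ht : p / (p + q) ∈ Set.Icc (0 : ℝ) 1 :=
    ⟨by positivity, by rw [div_le_one hpq]; linarith⟩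
  have hs : q / (p + q) ∈ Set.Icc (0 : ℝ) 1 :=
    ⟨by positivity, by rw [div_le_one hpq]; linarith⟩
  have pt (i : ZMod n) : p * q * dist (f i) (f (i + (j + 1))) ^ 2
      + p * q * dist (f (i + 1)) (f (i + 1 + (j + 1))) ^ 2 ≤
      p * q * dist (f i) (f (i + 1)) ^ 2
      + p * q * dist (f (i + (j + 1))) (f (i + (j + 1) + 1)) ^ 2
        + p ^ 2 * dist (f (i + 1)) (f (i + 1 + j)) ^ 2
        + q ^ 2 * dist (f i) (f (i + (j + 2))) ^ 2 := by
    have := h _ ht _ hs (f i) (f (i + 1)) (f (i + (j + 1))) (f (i + (j + 2)))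
    have e1 : i + 1 + (j + 1) = i + (j + 2) := by ring
    have e2 : i + (j + 1) + 1 = i + (j + 2) := by ring
    have e3 : i + 1 + j = i + (j + 1) := by ring
    rw [e1, e2, e3]
    rw [dist_comm (f (i + (j + 2))) (f i)] at this
    have e4 : 1 - p / (p + q) = q / (p + q) := by field_simp; ring
    have e5 : 1 - q / (p + q) = p / (p + q) := by field_simp; ring
    rw [e4, e5] at this
    have := mul_nonneg (sq_nonneg (p + q)) this
    field_simp at this
    linarith
  have sh (c : ZMod n) (F : ZMod n → ℝ) : ∑ i, F (i + c) = ∑ i, F i :=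
    Equiv.sum_comp (Equiv.addRight c) F
  have := Finset.sum_le_sum fun i (_ : i ∈ Finset.univ) => pt i
  simp only [Finset.sum_add_distrib, ← Finset.mul_sum] at this
  rw [sh 1 fun i => dist (f i) (f (i + (j + 1))) ^ 2, sh 1 fun i => dist (f i) (f (i + j)) ^ 2,
    sh (j + 1) fun i => dist (f i) (f (i + 1)) ^ 2] at this
  linarith

theorem SatisfiesBoxtimesInequalities.satisfiesWirInequalities {X : Type*} [MetricSpace X]
    (h : SatisfiesBoxtimesInequalities X) (n : ℕ) [NeZero n] (hn : 4 ≤ n) :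
    SatisfiesWirInequalities n X := by
  intro f j hj hjn
  have hn0 : (0 : ℝ) < n := by positivity
  have pos (k : ℕ) (hk : 1 ≤ k) (hk' : k < n) : 0 < Real.sin (k * Real.pi / n) := by
    have h2' : (k : ℝ) < n := by exact_mod_cast hk'
    have h1' : (0 : ℝ) < k := by exact_mod_cast hk
    apply Real.sin_pos_of_pos_of_lt_pi
    · positivity
    · rw [div_lt_iff₀ hn0, mul_comm]
      exact mul_lt_mul_of_pos_left h2' Real.pi_pos
  have key := ratio_le_of_trapezoid (n := n) (by omega)
    (fun j => ∑ i, dist (f i) (f (i + (j : ZMod n))) ^ 2) (fun j => Real.sin (j * Real.pi / n))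
    ?_ ?_ ?_ ?_ j (by omega) (by omega)
  · simp only [Nat.cast_one, one_mul] at key
    linarith
  · exact fun j h1 h2 => pos j h1 (by omega)
  · have e1 : ∑ i : ZMod n, dist (f i) (f (i + ((n - 1 : ℕ) : ZMod n))) ^ 2
        = ∑ i : ZMod n, dist (f i) (f (i + ((1 : ℕ) : ZMod n))) ^ 2 := by
      rw [← Equiv.sum_comp (Equiv.addRight (1 : ZMod n))]
      refine Finset.sum_congr rfl fun i _ => ?_
      rw [dist_comm]
      have : (((n - 1 : ℕ) : ZMod n)) = -1 := by
        rw [Nat.cast_sub (by omega)]; simp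
      simp [this]
    have e2 : Real.sin (((n - 1 : ℕ) : ℝ) * Real.pi / n) = Real.sin (((1 : ℕ) : ℝ) * Real.pi / n) := by
      rw [← Real.sin_pi_sub]
      congr 1
      rw [Nat.cast_sub (by omega)]
      field_simp
      push_cast
      ring
    simp only [e1, e2]
  · intro j
    have a1 : ((j + 2 : ℕ) : ℝ) * Real.pi / n
        = ((j + 1 : ℕ) : ℝ) * Real.pi / n + ((1 : ℕ) : ℝ) * Real.pi / n := by push_cast; ring
    have a2 : (j : ℝ) * Real.pi / n
        = ((j + 1 : ℕ) : ℝ) * Real.pi / n - ((1 : ℕ) : ℝ) * Real.pi / n := by push_cast; ring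
    simp only [a1, a2]
    rw [Real.sin_add, Real.sin_sub]
    have c1 := Real.sin_sq_add_cos_sq (((j + 1 : ℕ) : ℝ) * Real.pi / n)
    have c2 := Real.sin_sq_add_cos_sq (((1 : ℕ) : ℝ) * Real.pi / n)
    generalize Real.sin (((j + 1 : ℕ) : ℝ) * Real.pi / n) = A at *
    generalize Real.cos (((j + 1 : ℕ) : ℝ) * Real.pi / n) = B at *
    generalize Real.sin (((1 : ℕ) : ℝ) * Real.pi / n) = C at *
    generalize Real.cos (((1 : ℕ) : ℝ) * Real.pi / n) = E at *
    linear_combination A ^ 2 * c2 - C ^ 2 * c1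
  · intro j h1 h2
    have := sum_dist_sq_trapezoid h f (j : ZMod n) (pos (j + 2) (by omega) (by omega))
      (pos j h1 (by omega))
    simpa using this

/-! ### The Euclidean cone over the real line -/

/-- The cosine of the angle `x`, truncated at `π`. -/
noncomputable def coneCos (x : ℝ) : ℝ := Real.cos (min Real.pi |x|)

theorem coneCos_of_abs_le {x : ℝ} (h : |x| ≤ Real.pi) : coneCos x = Real.cos x := by
  rw [coneCos, min_eq_right h, Real.cos_abs]

theorem coneCos_of_le_abs {x : ℝ} (h : Real.pi ≤ |x|) : coneCos x = -1 := by
  rw [coneCos, min_eq_left h, Real.cos_pi]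

theorem coneCos_neg (x : ℝ) : coneCos (-x) = coneCos x := by
  rw [coneCos, abs_neg, coneCos]

theorem coneCos_le_one (x : ℝ) : coneCos x ≤ 1 := Real.cos_le_one _

theorem coneCos_zero : coneCos 0 = 1 := by
  rw [coneCos_of_abs_le (by simpa using Real.pi_pos.le), Real.cos_zero]

theorem coneCos_le_coneCos {x y : ℝ} (h : |y| ≤ |x|) : coneCos x ≤ coneCos y :=
  Real.cos_le_cos_of_nonneg_of_le_pi (le_min Real.pi_pos.le (abs_nonneg _)) (min_le_left _ _)
    (min_le_min_left _ h)

theorem coneCos_le_cos (x : ℝ) : coneCos x ≤ Real.cos x := by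
  rcases le_total |x| Real.pi with h | h
  · exact (coneCos_of_abs_le h).le
  · rw [coneCos_of_le_abs h]; exact Real.neg_one_le_cos x

theorem coneCos_add_nonpos {x y : ℝ} (h : Real.pi ≤ |x| + |y|) : coneCos x + coneCos y ≤ 0 := by
  rcases le_total |x| Real.pi with hx | hx
  · have : coneCos y ≤ coneCos (Real.pi - |x|) := by
      apply coneCos_le_coneCos
      rw [abs_of_nonneg (by linarith)]; linarith
    rw [coneCos_of_abs_le (x := Real.pi - |x|)
      (by rw [abs_of_nonneg (by linarith)]; linarith [abs_nonneg x]), Real.cos_pi_sub,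
      Real.cos_abs] at this
    rw [coneCos_of_abs_le hx]
    linarith
  · rw [coneCos_of_le_abs hx]; linarith [coneCos_le_one y]

/-- The squared distance between the points with polar coordinates `(r, θ)` and `(r', θ')` in the
Euclidean cone over the real line. -/
noncomputable def coneSq (r θ r' θ' : ℝ) : ℝ := r ^ 2 + r' ^ 2 - 2 * r * r' * coneCos (θ - θ')

theorem coneSq_comm (r θ r' θ' : ℝ) : coneSq r θ r' θ' = coneSq r' θ' r θ := by
  rw [coneSq, coneSq, ← coneCos_neg (θ - θ'), neg_sub]; ring

theorem coneSq_self (r θ : ℝ) : coneSq r θ r θ = 0 := by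
  rw [coneSq, sub_self, coneCos_zero]; ring

theorem coneSq_nonneg {r r' : ℝ} (hr : 0 ≤ r) (hr' : 0 ≤ r') (θ θ' : ℝ) :
    0 ≤ coneSq r θ r' θ' := by
  have := mul_le_mul_of_nonneg_left (coneCos_le_one (θ - θ')) (mul_nonneg hr hr')
  rw [coneSq]
  nlinarith [sq_nonneg (r - r')]

/-- The sum of two plane vectors at angle less than `π` lies in the sector between them; `ψ` is a
test direction for inner products. -/
theorem exists_polar_combination {r₁ r₂ θ₁ θ₂ : ℝ} (h1 : 0 ≤ r₁) (h2 : 0 ≤ r₂) (hle : θ₁ ≤ θ₂)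
    (hlt : θ₂ - θ₁ < Real.pi) : ∃ μ θ, 0 ≤ μ ∧ θ₁ ≤ θ ∧ θ ≤ θ₂ ∧
      ∀ ψ, r₁ * Real.cos (ψ - θ₁) + r₂ * Real.cos (ψ - θ₂) = μ * Real.cos (ψ - θ) := by
  obtain ⟨φ, rfl⟩ : ∃ φ, θ₂ = θ₁ + φ := ⟨θ₂ - θ₁, by ring⟩
  have hφ0 : 0 ≤ φ := by linarith
  have hφ1 : φ < Real.pi := by linarith
  have hsin := Real.sin_nonneg_of_nonneg_of_le_pi hφ0 hφ1.le
  set z : ℂ := ⟨r₁ + r₂ * Real.cos φ, r₂ * Real.sin φ⟩ with hz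
  have hre : ‖z‖ * Real.cos z.arg = r₁ + r₂ * Real.cos φ := Complex.norm_mul_cos_arg z
  have him : ‖z‖ * Real.sin z.arg = r₂ * Real.sin φ := Complex.norm_mul_sin_arg z
  have harg0 : 0 ≤ z.arg := Complex.arg_nonneg_iff.2 (mul_nonneg h2 hsin)
  refine ⟨‖z‖, θ₁ + z.arg, norm_nonneg _, by linarith, ?_, fun ψ => ?_⟩
  · by_contra! hcon
    have hgt : φ < z.arg := by linarith
    have hne : z ≠ 0 := by
      intro h0
      rw [h0, Complex.arg_zero] at hgt
      linarith
    have hpos : 0 < ‖z‖ := norm_pos_iff.2 hne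
    have hlt' : z.arg - φ < Real.pi := by
      rcases hφ0.eq_or_lt with h0 | h0
      · have : z = ((r₁ + r₂ : ℝ) : ℂ) := by
          rw [hz, ← h0]; apply Complex.ext <;> simp
        rw [this, Complex.arg_ofReal_of_nonneg (by positivity)] at hgt
        linarith
      · linarith [Complex.arg_le_pi z]
    have hs := Real.sin_pos_of_pos_of_lt_pi (by linarith : 0 < z.arg - φ) hlt'
    have : ‖z‖ * Real.sin (z.arg - φ) = - (r₁ * Real.sin φ) := by
      rw [Real.sin_sub]
      linear_combination Real.cos φ * him - Real.sin φ * hre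
    have h3 := mul_pos hpos hs
    have h4 := mul_nonneg h1 hsin
    linarith
  · have e1 : ψ - (θ₁ + φ) = (ψ - θ₁) - φ := by ring
    have e2 : ψ - (θ₁ + z.arg) = (ψ - θ₁) - z.arg := by ring
    rw [e1, e2, Real.cos_sub _ φ, Real.cos_sub _ z.arg]
    linear_combination -Real.cos (ψ - θ₁) * hre - Real.sin (ψ - θ₁) * him

/-- A substitute in the cone for vector addition: the inner product, with the truncated cosine,
becomes superadditive. -/
theorem exists_cone_combination {r₁ r₂ θ₁ θ₂ : ℝ} (h1 : 0 ≤ r₁) (h2 : 0 ≤ r₂) (hle : θ₁ ≤ θ₂) :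
    ∃ μ θ, 0 ≤ μ ∧ μ ^ 2 = r₁ ^ 2 + r₂ ^ 2 + 2 * r₁ * r₂ * coneCos (θ₁ - θ₂) ∧
      ∀ ψ, r₁ * coneCos (ψ - θ₁) + r₂ * coneCos (ψ - θ₂) ≤ μ * coneCos (ψ - θ) := by
  rcases lt_or_ge (θ₂ - θ₁) Real.pi with hlt | hge
  · obtain ⟨μ, θ, hμ, hθ1, hθ2, h⟩ := exists_polar_combination h1 h2 hle hlt
    have habs : |θ₁ - θ₂| ≤ Real.pi := by rw [abs_le]; constructor <;> linarith [Real.pi_pos]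
    refine ⟨μ, θ, hμ, ?_, fun ψ => ?_⟩
    · have c1 := h θ₁
      have c2 := h θ₂
      have c3 := h θ
      simp only [sub_self, Real.cos_zero, mul_one] at c1 c2 c3
      rw [← Real.cos_neg (θ₂ - θ₁), neg_sub] at c2
      rw [← Real.cos_neg (θ - θ₁), ← Real.cos_neg (θ - θ₂), neg_sub, neg_sub] at c3
      rw [coneCos_of_abs_le habs]
      linear_combination -μ * c3 - r₁ * c1 - r₂ * c2
    -- If `ψ` is further than `π` from `θ`, move it to distance exactly `π`: the truncated cosine to
    -- `θ` is unchanged and those to `θ₁`, `θ₂` can only grow.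
    · obtain ⟨ψ', e1, e2, e3⟩ : ∃ ψ', coneCos (ψ - θ) = Real.cos (ψ' - θ) ∧
          coneCos (ψ - θ₁) ≤ coneCos (ψ' - θ₁) ∧ coneCos (ψ - θ₂) ≤ coneCos (ψ' - θ₂) := by
        rcases le_total |ψ - θ| Real.pi with hψ | hψ
        · exact ⟨ψ, coneCos_of_abs_le hψ, le_rfl, le_rfl⟩
        rcases le_abs'.1 hψ with hψ' | hψ'
        · refine ⟨θ - Real.pi, ?_, ?_, ?_⟩
          · rw [coneCos_of_le_abs hψ, sub_sub_cancel_left, Real.cos_neg, Real.cos_pi]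
          · apply coneCos_le_coneCos
            rw [abs_of_nonpos (by linarith), abs_of_nonpos (by linarith)]
            linarith
          · apply coneCos_le_coneCos
            rw [abs_of_nonpos (by linarith), abs_of_nonpos (by linarith)]
            linarith
        · refine ⟨θ + Real.pi, ?_, ?_, ?_⟩
          · rw [coneCos_of_le_abs hψ, add_sub_cancel_left, Real.cos_pi]
          · apply coneCos_le_coneCos
            rw [abs_of_nonneg (by linarith), abs_of_nonneg (by linarith)]
            linarith
          · apply coneCos_le_coneCos
            rw [abs_of_nonneg (by linarith), abs_of_nonneg (by linarith)]
            linarith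
      rw [e1, ← h]
      exact add_le_add (mul_le_mul_of_nonneg_left (e2.trans (coneCos_le_cos _)) h1)
        (mul_le_mul_of_nonneg_left (e3.trans (coneCos_le_cos _)) h2)
  · have hc : coneCos (θ₁ - θ₂) = -1 :=
      coneCos_of_le_abs (by rw [abs_sub_comm]; exact hge.trans (le_abs_self _))
    have hsum (ψ : ℝ) : coneCos (ψ - θ₁) + coneCos (ψ - θ₂) ≤ 0 := by
      apply coneCos_add_nonpos
      have := abs_sub_abs_le_abs_sub (ψ - θ₁) (ψ - θ₂)
      have h3 : θ₂ - θ₁ ≤ |ψ - θ₁| + |ψ - θ₂| := by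
        linarith [le_abs_self (ψ - θ₁), neg_abs_le (ψ - θ₂)]
      linarith
    rcases le_total r₂ r₁ with hr | hr
    -- Here the two rays form a geodesic through the apex, so the longer vector survives with length
    -- the difference.
    · refine ⟨r₁ - r₂, θ₁, by linarith, by rw [hc]; ring, fun ψ => ?_⟩
      nlinarith [mul_nonneg h2 (neg_nonneg.2 (hsum ψ))]
    · refine ⟨r₂ - r₁, θ₂, by linarith, by rw [hc]; ring, fun ψ => ?_⟩
      nlinarith [mul_nonneg h1 (neg_nonneg.2 (hsum ψ))]

/-- The `CN`-inequality in the Euclidean cone over the real line. -/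
theorem exists_coneSq_le {r₁ r₂ t : ℝ} (h1 : 0 ≤ r₁) (h2 : 0 ≤ r₂)
    (ht : t ∈ Set.Icc (0 : ℝ) 1) (θ₁ θ₂ : ℝ) :
    ∃ μ θ, 0 ≤ μ ∧ ∀ r ψ, 0 ≤ r → coneSq r ψ μ θ ≤
      (1 - t) * coneSq r ψ r₁ θ₁ + t * coneSq r ψ r₂ θ₂ - t * (1 - t) * coneSq r₁ θ₁ r₂ θ₂ := by
  wlog hle : θ₁ ≤ θ₂ generalizing r₁ r₂ t θ₁ θ₂
  · obtain ⟨μ, θ, hμ, h⟩ := this (t := 1 - t) h2 h1 ⟨by linarith [ht.2], by linarith [ht.1]⟩ θ₂ θ₁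
      (not_le.1 hle).le
    refine ⟨μ, θ, hμ, fun r ψ hr => (h r ψ hr).trans_eq ?_⟩
    rw [coneSq_comm r₂]
    ring
  -- The point dividing the segment in ratio `t` is the cone sum of the vectors scaled by `1 - t`
  -- and `t`.
  obtain ⟨μ, θ, hμ, hsq, h⟩ := exists_cone_combination
    (mul_nonneg (sub_nonneg.2 ht.2) h1) (mul_nonneg ht.1 h2) hle
  refine ⟨μ, θ, hμ, fun r ψ hr => ?_⟩
  have := mul_le_mul_of_nonneg_left (h ψ) hr
  rw [coneSq, coneSq, coneSq, coneSq]
  nlinarith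

/-- The squared distance between the division points of the two diagonals is nonnegative; expanding
it by `CN` along each diagonal gives the `⊠`-inequality. -/
theorem isBoxForm_coneSq {ι : Type*} {r : ι → ℝ} (hr : ∀ i, 0 ≤ r i) (θ : ι → ℝ) :
    IsBoxForm fun i j => coneSq (r i) (θ i) (r j) (θ j) where
  self _ := coneSq_self _ _
  symm _ _ := coneSq_comm _ _ _ _
  box t ht s hs x y z w := by
    obtain ⟨μ, φ, hμ, h⟩ := exists_coneSq_le (hr x) (hr z) ht (θ x) (θ z)
    obtain ⟨ν, ψ, hν, h'⟩ := exists_coneSq_le (hr y) (hr w) hs (θ y) (θ w)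
    have a := h' μ φ hμ
    have b := coneSq_nonneg hμ hν φ ψ
    have c := mul_le_mul_of_nonneg_left (h _ (θ y) (hr y)) (sub_nonneg.2 hs.2)
    have d := mul_le_mul_of_nonneg_left (h _ (θ w) (hr w)) hs.1
    rw [coneSq_comm μ φ (r y), coneSq_comm μ φ (r w)] at a
    rw [coneSq_comm (r x) (θ x) (r y), coneSq_comm (r z) (θ z) (r w)]
    linarith

/-! ### The least concave majorant of a finite sequence -/

/-- Obtained by minimizing the sum of the values over a compact set of concave majorants. A
minimizer cannot be lowered at any single index, which forces contact at the ends and affinity off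
contact. -/
theorem exists_least_concave_majorant {x : ℕ → ℝ} (hx : ∀ k, x k < x (k + 1)) (p : ℕ → ℝ)
    (N : ℕ) : ∃ q : ℕ → ℝ, (∀ k, p k ≤ q k) ∧ q 0 = p 0 ∧ q N = p N ∧
      (∀ k, k + 2 ≤ N → (x (k + 2) - x (k + 1)) * q k + (x (k + 1) - x k) * q (k + 2)
        ≤ (x (k + 2) - x k) * q (k + 1)) ∧
      (∀ k, k + 2 ≤ N → p (k + 1) < q (k + 1) →
        (x (k + 2) - x (k + 1)) * q k + (x (k + 1) - x k) * q (k + 2)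
        = (x (k + 2) - x k) * q (k + 1)) := by
  obtain ⟨C, hC⟩ : ∃ C, ∀ k ≤ N, p k ≤ C := by
    obtain ⟨C, hC⟩ := ((Finset.range (N + 1)).image p).bddAbove
    exact ⟨C, fun k hk => hC (by simpa using ⟨k, by omega, rfl⟩)⟩
  set K : Set (ℕ → ℝ) := Set.univ.pi (fun k => Set.Icc (p k) (max C (p k))) ∩
    {q | ∀ k, k + 2 ≤ N → (x (k + 2) - x (k + 1)) * q k + (x (k + 1) - x k) * q (k + 2)
        ≤ (x (k + 2) - x k) * q (k + 1)} with hK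
  have hcomp : IsCompact K := by
    refine (isCompact_univ_pi fun k => isCompact_Icc).inter_right ?_
    simp only [Set.ofPred_forall]
    refine isClosed_iInter fun k => isClosed_iInter fun _ => isClosed_le ?_ ?_ <;> fun_prop
  have hne : K.Nonempty := by
    refine ⟨fun k => max C (p k), fun k _ => ⟨le_max_right _ _, le_rfl⟩, fun k hk => ?_⟩
    simp only
    rw [max_eq_left (hC k (by omega)), max_eq_left (hC (k + 1) (by omega)),
      max_eq_left (hC (k + 2) (by omega))]
    linarith
  obtain ⟨q, ⟨hqb, hqc⟩, hmin⟩ := hcomp.exists_isMinOn hne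
    (f := fun q => ∑ k ∈ Finset.range (N + 1), q k) (by fun_prop)
  simp only [Set.mem_pi, Set.mem_univ, true_imp_iff, Set.mem_Icc] at hqb
  -- Lowering one value preserves concavity at every other index, so only the condition centred at
  -- `k` needs checking.
  have low (k : ℕ) (hk : k ≤ N) (v : ℝ) (hv : p k ≤ v) (hvq : v ≤ q k)
      (hint : ∀ l, l + 1 = k → l + 2 ≤ N →
        (x (l + 2) - x (l + 1)) * q l + (x (l + 1) - x l) * q (l + 2)
        ≤ (x (l + 2) - x l) * v) : q k ≤ v := by
    have hmem : Function.update q k v ∈ K := by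
      refine ⟨fun i _ => ?_, fun l hl => ?_⟩
      · by_cases hi : i = k
        · subst hi
          simpa using ⟨hv, le_max_iff.1 (hvq.trans (hqb i).2)⟩
        · simpa [hi] using hqb i
      · have x1 := hx l
        have x2 := hx (l + 1)
        have x3 : x (l + 1) < x (l + 2) := x2
        by_cases h1 : l + 1 = k
        · have := hint l h1 hl
          subst h1
          simpa using this
        have u (i : ℕ) : Function.update q k v i ≤ q i := by
          by_cases hi : i = k
          · subst hi; simpa using hvq
          · simp [hi]
        rw [Function.update_of_ne h1]
        have := mul_le_mul_of_nonneg_left (u l) (sub_nonneg.2 x3.le)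
        have := mul_le_mul_of_nonneg_left (u (l + 2)) (sub_nonneg.2 x1.le)
        linarith [hqc l hl]
    have hm := hmin hmem
    simp only [Set.mem_ofPred_eq] at hm
    have hkm : k ∈ Finset.range (N + 1) := Finset.mem_range.2 (by omega)
    rw [Finset.sum_update_of_mem hkm, Finset.sum_eq_add_sum_sdiff_singleton_of_mem hkm] at hm
    linarith
  refine ⟨q, fun k => (hqb k).1, ?_, ?_, hqc, fun k hk hlt => ?_⟩
  · exact le_antisymm (low 0 (by omega) _ le_rfl (hqb 0).1 (by omega)) (hqb 0).1
  · exact le_antisymm (low N le_rfl _ le_rfl (hqb N).1 (by omega)) (hqb N).1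
  · refine le_antisymm (hqc k hk) ?_
    have x1 := hx k
    have x2 : x (k + 1) < x (k + 2) := hx (k + 1)
    have x3 : 0 < x (k + 2) - x k := by linarith
    set v := ((x (k + 2) - x (k + 1)) * q k + (x (k + 1) - x k) * q (k + 2)) / (x (k + 2) - x k)
      with hv
    have hvq : v ≤ q (k + 1) := by rw [hv, div_le_iff₀ x3, mul_comm (q (k + 1))]; exact hqc k hk
    have hv' : (x (k + 2) - x (k + 1)) * q k + (x (k + 1) - x k) * q (k + 2)
        = (x (k + 2) - x k) * v := by rw [hv]; field_simp
    have := low (k + 1) (by omega) (max (p (k + 1)) v) (le_max_left _ _) (max_le hlt.le hvq)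
      (by
        intro l hl _
        obtain rfl : l = k := by omega
        rw [hv']
        exact mul_le_mul_of_nonneg_left (le_max_right _ _) x3.le)
    rcases le_max_iff.1 this with h | h
    · linarith
    · rw [hv']
      exact mul_le_mul_of_nonneg_left h x3.le

/-! ### Convex chains in the plane -/

/-- With `p = A√R cos α`, `X = A√R sin α`, `q = B√R cos β`, `Y = B√R sin β` and `α, β` in `(0, π)`:
if `cos α + cos β ≤ 0` then `α + β ≥ π`, so `sin (α + β) ≤ 0`. -/
theorem mul_add_mul_nonpos_of_sq {A B R p q X Y : ℝ} (hA : 0 < A) (hB : 0 < B) (hX : 0 < X)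
    (hY : 0 < Y) (hAp : A ^ 2 * R = p ^ 2 + X ^ 2) (hBq : B ^ 2 * R = q ^ 2 + Y ^ 2)
    (h : B * p + A * q ≤ 0) : p * Y + q * X ≤ 0 := by
  have key : A ^ 2 * (q ^ 2 + Y ^ 2) = B ^ 2 * (p ^ 2 + X ^ 2) := by rw [← hAp, ← hBq]; ring
  rcases le_or_gt p 0 with hp | hp <;> rcases le_or_gt q 0 with hq | hq
  · nlinarith
  · have h1 : (A * q) ^ 2 ≤ (B * p) ^ 2 := by
      have := mul_pos hA hq
      rw [← neg_sq (B * p)]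
      exact pow_le_pow_left₀ this.le (by linarith) 2
    have h2 : (B * X) ^ 2 ≤ (A * Y) ^ 2 := by nlinarith
    have h3 : B * X ≤ A * Y := (pow_le_pow_iff_left₀ (by positivity) (by positivity) two_ne_zero).1 h2
    have h4 : A * q * (B * X) ≤ -(B * p) * (A * Y) :=
      mul_le_mul (by linarith) h3 (by positivity) (by nlinarith)
    have : (A * B) * (p * Y + q * X) ≤ 0 := by linarith
    exact nonpos_of_mul_nonpos_right this (by positivity)
  · have h1 : (B * p) ^ 2 ≤ (A * q) ^ 2 := by
      have := mul_pos hB hp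
      rw [← neg_sq (A * q)]
      exact pow_le_pow_left₀ this.le (by linarith) 2
    have h2 : (A * Y) ^ 2 ≤ (B * X) ^ 2 := by nlinarith
    have h3 : A * Y ≤ B * X := (pow_le_pow_iff_left₀ (by positivity) (by positivity) two_ne_zero).1 h2
    have h4 : B * p * (A * Y) ≤ -(A * q) * (B * X) :=
      mul_le_mul (by linarith) h3 (by positivity) (by nlinarith)
    have : (A * B) * (p * Y + q * X) ≤ 0 := by linarith
    exact nonpos_of_mul_nonpos_right this (by positivity)
  · nlinarith [mul_pos hA hq, mul_pos hB hp]

/-- The oriented area spanned by the `j`-th and the `k`-th point. -/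
def areaForm (X Y : ℕ → ℝ) (j k : ℕ) : ℝ := X j * Y k - X k * Y j

/-- The squared distance between the `j`-th and the `k`-th point. -/
def planeSq (X Y : ℕ → ℝ) (j k : ℕ) : ℝ := (X j - X k) ^ 2 + (Y j - Y k) ^ 2

section Plane

variable {X Y : ℕ → ℝ} {i j k l : ℕ} {A B : ℝ}

/-- By Stewart's theorem, a radius at `j` at least that of the straight configuration makes the
chain convex at `j`, seen from the origin. -/
theorem areaForm_add_nonneg (h1 : 0 < areaForm X Y i j) (h2 : 0 < areaForm X Y j k) (hA : 0 < A)
    (hB : 0 < B) (hij : planeSq X Y i j = A ^ 2) (hjk : planeSq X Y j k = B ^ 2)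
    (h : B * (X i ^ 2 + Y i ^ 2) + A * (X k ^ 2 + Y k ^ 2) - A * B * (A + B)
      ≤ (A + B) * (X j ^ 2 + Y j ^ 2)) :
    areaForm X Y i k ≤ areaForm X Y i j + areaForm X Y j k := by
  have hR : 0 < X j ^ 2 + Y j ^ 2 := by
    rcases (add_nonneg (sq_nonneg (X j)) (sq_nonneg (Y j))).eq_or_lt with h0 | h0
    · have hx : X j = 0 := by nlinarith
      have hy : Y j = 0 := by nlinarith
      rw [areaForm, hx, hy] at h1
      simp at h1
    · exact h0
  have := mul_add_mul_nonpos_of_sq (R := X j ^ 2 + Y j ^ 2)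
    (p := (X i - X j) * X j + (Y i - Y j) * Y j) (q := (X k - X j) * X j + (Y k - Y j) * Y j)
    hA hB h1 h2 (by rw [← hij, planeSq, areaForm]; ring) (by rw [← hjk, planeSq, areaForm]; ring)
    (by rw [planeSq] at hij hjk; nlinarith)
  have h3 : 0 ≤ (X j ^ 2 + Y j ^ 2) * (areaForm X Y i j + areaForm X Y j k - areaForm X Y i k) := by
    refine (neg_nonneg.2 this).trans_eq ?_
    simp only [areaForm]; ring
  linarith [nonneg_of_mul_nonneg_right h3 hR]

/-- The equality case of Stewart: `i, j, k` are collinear. -/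
theorem areaForm_add_eq (h1 : 0 < areaForm X Y i j) (h2 : 0 < areaForm X Y j k) (hA : 0 < A)
    (hB : 0 < B) (hij : planeSq X Y i j = A ^ 2) (hjk : planeSq X Y j k = B ^ 2)
    (h : B * (X i ^ 2 + Y i ^ 2) + A * (X k ^ 2 + Y k ^ 2) - A * B * (A + B)
      = (A + B) * (X j ^ 2 + Y j ^ 2)) :
    areaForm X Y i k = areaForm X Y i j + areaForm X Y j k ∧ planeSq X Y i k = (A + B) ^ 2 := by
  have hR : 0 < X j ^ 2 + Y j ^ 2 := by
    rcases (add_nonneg (sq_nonneg (X j)) (sq_nonneg (Y j))).eq_or_lt with h0 | h0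
    · have hx : X j = 0 := by nlinarith
      have hy : Y j = 0 := by nlinarith
      rw [areaForm, hx, hy] at h1
      simp at h1
    · exact h0
  obtain ⟨p, hp⟩ : ∃ p, p = (X i - X j) * X j + (Y i - Y j) * Y j := ⟨_, rfl⟩
  obtain ⟨q, hq⟩ : ∃ q, q = (X k - X j) * X j + (Y k - Y j) * Y j := ⟨_, rfl⟩
  have e1 : A ^ 2 * (X j ^ 2 + Y j ^ 2) = p ^ 2 + areaForm X Y i j ^ 2 := by
    rw [← hij, planeSq, areaForm, hp]; ring
  have e2 : B ^ 2 * (X j ^ 2 + Y j ^ 2) = q ^ 2 + areaForm X Y j k ^ 2 := by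
    rw [← hjk, planeSq, areaForm, hq]; ring
  have e3 : B * p + A * q = 0 := by
    rw [planeSq] at hij hjk
    rw [hp, hq]
    linear_combination h / 2 - B / 2 * hij - A / 2 * hjk
  have e4 : B * areaForm X Y i j = A * areaForm X Y j k := by
    refine (pow_left_inj₀ (by positivity) (by positivity) two_ne_zero).1 ?_
    linear_combination -B ^ 2 * e1 + A ^ 2 * e2 + (A * q - B * p) * e3
  have e5 : p * areaForm X Y j k + q * areaForm X Y i j = 0 := by
    have : A * B * (p * areaForm X Y j k + q * areaForm X Y i j) = 0 := by
      linear_combination A * areaForm X Y j k * e3 + A * q * e4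
    simpa [hA.ne', hB.ne'] using this
  have e6 : (X j ^ 2 + Y j ^ 2) * (areaForm X Y i k - (areaForm X Y i j + areaForm X Y j k)) = 0 := by
    rw [hp, hq] at e5
    simp only [areaForm] at e5 ⊢
    linear_combination e5
  have e7 : p * q - areaForm X Y i j * areaForm X Y j k = -(A * B * (X j ^ 2 + Y j ^ 2)) := by
    have : B * (p * q - areaForm X Y i j * areaForm X Y j k + A * B * (X j ^ 2 + Y j ^ 2)) = 0 := by
      linear_combination A * e2 + q * e3 - areaForm X Y j k * e4
    have := (mul_eq_zero.1 this).resolve_left hB.ne'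
    linarith
  have e8 : (X j ^ 2 + Y j ^ 2) * (planeSq X Y i k - (A + B) ^ 2) = 0 := by
    rw [hp, hq] at e7
    simp only [areaForm, planeSq] at e7 hij hjk ⊢
    linear_combination (X j ^ 2 + Y j ^ 2) * (hij + hjk) - 2 * e7
  constructor
  · linarith [(mul_eq_zero.1 e6).resolve_left hR.ne']
  · linarith [(mul_eq_zero.1 e8).resolve_left hR.ne']

/-- This identity and the next express a convexity defect through those of shorter chains, which
drives the induction in `areaForm_le_of_local`. -/
theorem areaForm_mul_right (X Y : ℕ → ℝ) (j k l m : ℕ) :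
    areaForm X Y k l * (areaForm X Y j k + areaForm X Y k m - areaForm X Y j m) =
      areaForm X Y j k * (areaForm X Y k l + areaForm X Y l m - areaForm X Y k m)
      + areaForm X Y k m * (areaForm X Y j k + areaForm X Y k l - areaForm X Y j l) := by
  simp only [areaForm]; ring

theorem areaForm_mul_left (X Y : ℕ → ℝ) (j k l m : ℕ) :
    areaForm X Y k l * (areaForm X Y j l + areaForm X Y l m - areaForm X Y j m) =
      areaForm X Y l m * (areaForm X Y j k + areaForm X Y k l - areaForm X Y j l)
      + areaForm X Y j l * (areaForm X Y k l + areaForm X Y l m - areaForm X Y k m) := by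
  simp only [areaForm]; ring

/-- A star-shaped chain that is convex at each of its vertices is convex. -/
theorem areaForm_le_of_local {a b : ℕ}
    (hpos : ∀ j k, a ≤ j → j < k → k ≤ b → 0 < areaForm X Y j k)
    (hloc : ∀ k, a ≤ k → k + 2 ≤ b →
      areaForm X Y k (k + 2) ≤ areaForm X Y k (k + 1) + areaForm X Y (k + 1) (k + 2))
    (haj : a ≤ j) (hjk : j < k) (hkl : k < l) (hlb : l ≤ b) :
    areaForm X Y j l ≤ areaForm X Y j k + areaForm X Y k l := by
  obtain ⟨n, hn⟩ : ∃ n, l - j ≤ n := ⟨_, le_rfl⟩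
  induction n generalizing j k l with
  | zero => omega
  | succ n ih =>
    by_cases h1 : k + 1 < l
    · have h2 := ih (j := k) (k := k + 1) (l := l) (by omega) (by omega) h1 hlb (by omega)
      have h3 := ih (j := j) (k := k) (l := k + 1) haj hjk (by omega) (by omega) (by omega)
      have h4 := areaForm_mul_right X Y j k (k + 1) l
      have h5 : 0 ≤ areaForm X Y k (k + 1) *
          (areaForm X Y j k + areaForm X Y k l - areaForm X Y j l) := by
        rw [h4]
        exact add_nonneg (mul_nonneg (hpos _ _ haj hjk (by omega)).le (by linarith))
          (mul_nonneg (hpos _ _ (by omega) hkl hlb).le (by linarith))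
      linarith [nonneg_of_mul_nonneg_right h5 (hpos k (k + 1) (by omega) (by omega) (by omega))]
    obtain rfl : l = k + 1 := by omega
    obtain ⟨m, rfl⟩ : ∃ m, k = m + 1 := ⟨k - 1, by omega⟩
    by_cases h1 : j = m
    · subst h1
      exact hloc j haj hlb
    · have h2 := ih (j := j) (k := m) (l := m + 1) haj (by omega) (by omega) (by omega) (by omega)
      have h3 := hloc m (by omega) hlb
      have h4 := areaForm_mul_left X Y j m (m + 1) (m + 1 + 1)
      have h5 : 0 ≤ areaForm X Y m (m + 1) * (areaForm X Y j (m + 1)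
          + areaForm X Y (m + 1) (m + 1 + 1) - areaForm X Y j (m + 1 + 1)) := by
        rw [h4]
        exact add_nonneg (mul_nonneg (hpos _ _ (by omega) hkl hlb).le (by linarith))
          (mul_nonneg (hpos _ _ haj hjk (by omega)).le (by linarith))
      linarith [nonneg_of_mul_nonneg_right h5 (hpos m (m + 1) (by omega) (by omega) (by omega))]

/-- Comparison with a planar quadrilateral `0, j, k, l` whose diagonals cross. -/
theorem IsBoxForm.le_planeSq {ι : Type*} {D : ι → ι → ℝ} (hD : IsBoxForm D) {x y z w : ι}
    (hjk : 0 < areaForm X Y j k) (hkl : 0 < areaForm X Y k l) (hjl : 0 ≤ areaForm X Y j l)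
    (hle : areaForm X Y j l ≤ areaForm X Y j k + areaForm X Y k l)
    (hxy : D x y ≤ X j ^ 2 + Y j ^ 2) (hxz : D x z = X k ^ 2 + Y k ^ 2)
    (hxw : D x w ≤ X l ^ 2 + Y l ^ 2) (hyz : D y z ≤ planeSq X Y j k)
    (hzw : D z w ≤ planeSq X Y k l) : D y w ≤ planeSq X Y j l := by
  obtain ⟨a, ha⟩ : ∃ a, a = areaForm X Y j k := ⟨_, rfl⟩
  obtain ⟨b, hb⟩ : ∃ b, b = areaForm X Y k l := ⟨_, rfl⟩
  obtain ⟨c, hc⟩ : ∃ c, c = areaForm X Y j l := ⟨_, rfl⟩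
  rw [← ha] at hjk hle
  rw [← hb] at hkl hle
  rw [← hc] at hjl hle
  have hab : 0 < a + b := by positivity
  have eX : c * X k = b * X j + a * X l := by rw [ha, hb, hc]; simp only [areaForm]; ring
  have eY : c * Y k = b * Y j + a * Y l := by rw [ha, hb, hc]; simp only [areaForm]; ring
  -- The weights locate the crossing: `c k = b j + a l` by `eX`, `eY`. Hence the planar
  -- `⊠`-expression vanishes (`key`), and the box inequality bounds `D y w`.
  have box := hD.box (c / (a + b)) ⟨by positivity, by rw [div_le_one hab]; exact hle⟩ (a / (a + b))
    ⟨by positivity, by rw [div_le_one hab]; linarith⟩ x y z w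
  have box' := mul_nonneg (sq_nonneg (a + b)) box
  have e : (a + b) ^ 2 * ((1 - c / (a + b)) * (1 - a / (a + b)) * D x y
      + c / (a + b) * (1 - a / (a + b)) * D y z + c / (a + b) * (a / (a + b)) * D z w
      + (1 - c / (a + b)) * (a / (a + b)) * D w x
      - c / (a + b) * (1 - c / (a + b)) * D x z - a / (a + b) * (1 - a / (a + b)) * D y w)
      = (a + b - c) * b * D x y + c * b * D y z + c * a * D z w + (a + b - c) * a * D x w
        - c * (a + b - c) * D x z - a * b * D y w := by
    rw [hD.symm w x]
    field_simp
    ring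
  rw [e, hxz] at box'
  have hcab : 0 ≤ a + b - c := by linarith
  have m1 := mul_le_mul_of_nonneg_left hxy (mul_nonneg hcab hkl.le)
  have m2 := mul_le_mul_of_nonneg_left hyz (mul_nonneg hjl hkl.le)
  have m3 := mul_le_mul_of_nonneg_left hzw (mul_nonneg hjl hjk.le)
  have m4 := mul_le_mul_of_nonneg_left hxw (mul_nonneg hcab hjk.le)
  have key : (a + b - c) * b * (X j ^ 2 + Y j ^ 2) + c * b * planeSq X Y j k
      + c * a * planeSq X Y k l + (a + b - c) * a * (X l ^ 2 + Y l ^ 2)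
      - c * (a + b - c) * (X k ^ 2 + Y k ^ 2) - a * b * planeSq X Y j l = 0 := by
    simp only [planeSq]
    linear_combination (c * X k - b * X j - a * X l) * eX + (c * Y k - b * Y j - a * Y l) * eY
  have : a * b * D y w ≤ a * b * planeSq X Y j l := by linarith
  exact le_of_mul_le_mul_left this (by positivity)

end Plane

/-! ### Developing a fan of triangles in the cone -/

theorem exists_slope_of_linear {x q : ℕ → ℝ} (hx : ∀ k, x k < x (k + 1)) {j l : ℕ}
    (h : ∀ i, j ≤ i → i + 2 ≤ l → (x (i + 2) - x (i + 1)) * q i + (x (i + 1) - x i) * q (i + 2)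
      = (x (i + 2) - x i) * q (i + 1)) :
    ∃ σ, ∀ i, j ≤ i → i ≤ l → q i = q j + σ * (x i - x j) := by
  refine ⟨(q (j + 1) - q j) / (x (j + 1) - x j), ?_⟩
  set σ := (q (j + 1) - q j) / (x (j + 1) - x j) with hσ
  have h1 : q (j + 1) = q j + σ * (x (j + 1) - x j) := by
    have : x (j + 1) - x j ≠ 0 := (sub_pos.2 (hx j)).ne'
    rw [hσ]; field_simp; ring
  have key (m : ℕ) : (j + m ≤ l → q (j + m) = q j + σ * (x (j + m) - x j)) ∧
      (j + m + 1 ≤ l → q (j + m + 1) = q j + σ * (x (j + m + 1) - x j)) := by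
    induction m with
    | zero => exact ⟨fun _ => by simp, fun _ => h1⟩
    | succ m ih =>
      refine ⟨ih.2, fun hm => ?_⟩
      have e := h (j + m) (by omega) hm
      rw [ih.1 (by omega), ih.2 (by omega)] at e
      have hne : x (j + m + 1) - x (j + m) ≠ 0 := (sub_pos.2 (hx _)).ne'
      refine mul_left_cancel₀ hne ?_
      change (x (j + m + 1) - x (j + m)) * q (j + m + 2) =
        (x (j + m + 1) - x (j + m)) * (q j + σ * (x (j + m + 2) - x j))
      linear_combination e
  intro i hi hil
  obtain ⟨m, rfl⟩ := Nat.exists_eq_add_of_le hi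
  exact (key m).1 hil

/-- For a point moving along a line at arc length `x`, the quantity `ρ² - x²` is affine in `x`.
Concavity of it thus means a convex chain and affinity a straight one, so `ρ² - x²` is taken to be
the least concave majorant of `r² - x²`. -/
theorem exists_convex_radii {r x : ℕ → ℝ} (hx : ∀ k, x k < x (k + 1)) (hr : ∀ k, 0 < r k)
    (htri : ∀ a b, a < b → r b < r a + (x b - x a) ∧ r a < r b + (x b - x a)) (N : ℕ) :
    ∃ ρ : ℕ → ℝ, (∀ k, r k ≤ ρ k) ∧ ρ 0 = r 0 ∧ ρ N = r N ∧
      (∀ k, k + 1 ≤ N → |ρ k - ρ (k + 1)| < x (k + 1) - x k) ∧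
      (∀ k, k + 2 ≤ N → (x (k + 2) - x (k + 1)) * ρ k ^ 2 + (x (k + 1) - x k) * ρ (k + 2) ^ 2
        - (x (k + 1) - x k) * (x (k + 2) - x (k + 1)) * (x (k + 2) - x k)
        ≤ (x (k + 2) - x k) * ρ (k + 1) ^ 2) ∧
      ∀ j k, k ≤ N → (∀ i, j < i → i < k → r i ≠ ρ i) → ∀ i, j < i → i < k →
        (x k - x i) * ρ j ^ 2 + (x i - x j) * ρ k ^ 2 - (x i - x j) * (x k - x i) * (x k - x j)
        = (x k - x j) * ρ i ^ 2 := by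
  have hmono : StrictMono x := strictMono_nat_of_lt_succ hx
  obtain ⟨q, hpq, hq0, hqN, hconc, hlin⟩ :=
    exists_least_concave_majorant hx (fun k => r k ^ 2 - x k ^ 2) N
  have hnn (k : ℕ) : 0 ≤ q k + x k ^ 2 := by nlinarith [hpq k, sq_nonneg (r k)]
  obtain ⟨ρ, hρ⟩ : ∃ ρ : ℕ → ℝ, ∀ k, ρ k = √(q k + x k ^ 2) := ⟨_, fun _ => rfl⟩
  have hρ2 (k : ℕ) : ρ k ^ 2 = q k + x k ^ 2 := by rw [hρ, Real.sq_sqrt (hnn k)]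
  have hrρ (k : ℕ) : r k ≤ ρ k := by
    rw [hρ]; exact Real.le_sqrt_of_sq_le (by linarith [hpq k])
  have hcontact (k : ℕ) (h : q k = r k ^ 2 - x k ^ 2) : ρ k = r k := by
    rw [hρ, h, sub_add_cancel, Real.sqrt_sq (hr k).le]
  have hne (k : ℕ) (h : r k ≠ ρ k) : r k ^ 2 - x k ^ 2 < q k :=
    (hpq k).lt_of_ne fun h' => h (hcontact k h'.symm).symm
  have haff (j k : ℕ) (hk : k ≤ N) (h : ∀ i, j < i → i < k → r i ≠ ρ i) :
      ∃ σ, ∀ i, j ≤ i → i ≤ k → q i = q j + σ * (x i - x j) :=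
    exists_slope_of_linear hx fun i hi hik =>
      hlin i (by omega) (hne _ (h (i + 1) (by omega) (by omega)))
  refine ⟨ρ, hrρ, hcontact 0 hq0, hcontact N hqN, fun k hk => ?_, fun k hk => ?_,
    fun j k hk h i hji hik => ?_⟩
  · classical
    have hex : ∃ b, k + 1 ≤ b ∧ r b = ρ b := ⟨N, hk, (hcontact N hqN).symm⟩
    obtain ⟨hb1, hb2⟩ := Nat.find_spec hex
    have hbmin := fun m => Nat.find_min (m := m) hex
    have hbN : Nat.find hex ≤ N := Nat.find_min' hex ⟨hk, (hcontact N hqN).symm⟩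
    set b := Nat.find hex
    have ha1 : Nat.findGreatest (fun a => r a = ρ a) k ≤ k := Nat.findGreatest_le k
    have ha2 : r (Nat.findGreatest (fun a => r a = ρ a) k)
        = ρ (Nat.findGreatest (fun a => r a = ρ a) k) :=
      Nat.findGreatest_spec (P := fun a => r a = ρ a) (Nat.zero_le k) (hcontact 0 hq0).symm
    have hamax := fun m => Nat.findGreatest_is_greatest (P := fun a => r a = ρ a) (n := k) (k := m)
    set a := Nat.findGreatest (fun a => r a = ρ a) k
    -- Between the contact indices `a ≤ k < b` nearest to the edge, `q` has constant slope `σ`.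
    -- Triangle inequalities with the true radii at `b` and `a` bound `σ` on both sides, which is
    -- what the new triangle needs.
    obtain ⟨σ, hσ⟩ := haff a b hbN (by
      intro i hai hib
      rcases le_or_gt i k with hik | hik
      · exact hamax i hai hik
      · exact fun h => hbmin i hib ⟨hik, h⟩)
    have eb := hσ b (by omega) le_rfl
    have ek := hσ k ha1 (by omega)
    have ek1 := hσ (k + 1) (by omega) hb1
    have hxk := hx k
    have hρk : 0 < ρ k := (hr k).trans_le (hrρ k)
    have hρk1 : 0 < ρ (k + 1) := (hr (k + 1)).trans_le (hrρ (k + 1))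
    have sq (k : ℕ) : q k = ρ k ^ 2 - x k ^ 2 := by linarith [hρ2 k]
    rw [sq, sq] at eb ek ek1
    have h1 : σ < 2 * (ρ k - x k) := by
      have hxb : 0 < x b - x k := sub_pos.2 (hmono (by omega))
      have t := (htri k b (by omega)).1
      rw [hb2] at t
      have t' : ρ b ^ 2 < (ρ k + (x b - x k)) ^ 2 :=
        pow_lt_pow_left₀ (by linarith [hrρ k]) ((hr b).le.trans (hrρ b)) two_ne_zero
      have : (x b - x k) * σ < (x b - x k) * (2 * (ρ k - x k)) := by linarith
      exact lt_of_mul_lt_mul_left this hxb.le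
    have h2 : -σ < 2 * (ρ (k + 1) + x (k + 1)) := by
      have hxa : 0 < x (k + 1) - x a := sub_pos.2 (hmono (by omega))
      have t := (htri a (k + 1) (by omega)).2
      rw [ha2] at t
      have t' : ρ a ^ 2 < (ρ (k + 1) + (x (k + 1) - x a)) ^ 2 :=
        pow_lt_pow_left₀ (by linarith [hrρ (k + 1)]) ((hr a).le.trans (hrρ a)) two_ne_zero
      have : (x (k + 1) - x a) * (-σ) < (x (k + 1) - x a) * (2 * (ρ (k + 1) + x (k + 1))) := by
        linarith
      exact lt_of_mul_lt_mul_left this hxa.le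
    have h1' := mul_lt_mul_of_pos_left h1 (sub_pos.2 hxk)
    have h2' := mul_lt_mul_of_pos_left h2 (sub_pos.2 hxk)
    have h3 : ρ (k + 1) ^ 2 < (ρ k + (x (k + 1) - x k)) ^ 2 := by linarith
    have h4 : ρ k ^ 2 < (ρ (k + 1) + (x (k + 1) - x k)) ^ 2 := by linarith
    have h5 := lt_of_pow_lt_pow_left₀ 2 (by linarith) h3
    have h6 := lt_of_pow_lt_pow_left₀ 2 (by linarith) h4
    rw [abs_lt]
    constructor <;> linarith
  · rw [hρ2, hρ2, hρ2]
    linarith [hconc k hk]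
  · obtain ⟨σ, hσ⟩ := haff j k hk h
    rw [hρ2, hρ2, hρ2, hσ k (by omega) le_rfl, hσ i hji.le hik.le]
    ring

theorem exists_angle {a b c : ℝ} (ha : 0 < a) (hb : 0 < b) (h1 : |a - b| < c) (h2 : c < a + b) :
    0 < Real.arccos ((a ^ 2 + b ^ 2 - c ^ 2) / (2 * a * b)) ∧
    Real.arccos ((a ^ 2 + b ^ 2 - c ^ 2) / (2 * a * b)) < Real.pi ∧
    a ^ 2 + b ^ 2 - 2 * a * b * Real.cos (Real.arccos ((a ^ 2 + b ^ 2 - c ^ 2) / (2 * a * b)))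
      = c ^ 2 := by
  have hab : 0 < 2 * a * b := by positivity
  have hc : 0 < c := (abs_nonneg _).trans_lt h1
  have hc1 : (a - b) ^ 2 < c ^ 2 := sq_lt_sq.2 (by rwa [abs_of_pos hc])
  have hc2 : c ^ 2 < (a + b) ^ 2 := pow_lt_pow_left₀ h2 hc.le two_ne_zero
  have l1 : (a ^ 2 + b ^ 2 - c ^ 2) / (2 * a * b) < 1 := by rw [div_lt_one hab]; linarith
  have l2 : -1 < (a ^ 2 + b ^ 2 - c ^ 2) / (2 * a * b) := by rw [lt_div_iff₀ hab]; linarith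
  refine ⟨Real.arccos_pos.2 l1, (Real.arccos_le_pi _).lt_of_ne ?_, ?_⟩
  · rw [Ne, Real.arccos_eq_pi]
    exact not_le.2 l2
  · rw [Real.cos_arccos l2.le l1.le]
    field_simp
    ring

section Polar

variable {ρ θ : ℕ → ℝ} {j k : ℕ}

theorem areaForm_polar (ρ θ : ℕ → ℝ) (j k : ℕ) :
    areaForm (fun i => ρ i * Real.cos (θ i)) (fun i => ρ i * Real.sin (θ i)) j k
      = ρ j * ρ k * Real.sin (θ k - θ j) := by
  rw [areaForm, Real.sin_sub]; ring

theorem areaForm_polar_pos (hρ : ∀ k, 0 < ρ k) (h1 : θ j < θ k) (h2 : θ k - θ j < Real.pi) :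
    0 < areaForm (fun i => ρ i * Real.cos (θ i)) (fun i => ρ i * Real.sin (θ i)) j k := by
  rw [areaForm_polar]
  exact mul_pos (mul_pos (hρ j) (hρ k)) (Real.sin_pos_of_pos_of_lt_pi (by linarith) h2)

theorem planeSq_polar (h : |θ j - θ k| ≤ Real.pi) :
    planeSq (fun i => ρ i * Real.cos (θ i)) (fun i => ρ i * Real.sin (θ i)) j k
      = coneSq (ρ j) (θ j) (ρ k) (θ k) := by
  rw [planeSq, coneSq, coneCos_of_abs_le h, Real.cos_sub]
  linear_combination ρ j ^ 2 * Real.sin_sq_add_cos_sq (θ j) + ρ k ^ 2 * Real.sin_sq_add_cos_sq (θ k)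

theorem polar_sq_add_sq (ρ θ : ℕ → ℝ) (k : ℕ) :
    (ρ k * Real.cos (θ k)) ^ 2 + (ρ k * Real.sin (θ k)) ^ 2 = ρ k ^ 2 := by
  linear_combination ρ k ^ 2 * Real.sin_sq_add_cos_sq (θ k)

theorem coneSq_of_pi_le {r r' φ φ' : ℝ} (h : Real.pi ≤ |φ - φ'|) :
    coneSq r φ r' φ' = (r + r') ^ 2 := by
  rw [coneSq, coneCos_of_le_abs h]; ring

end Polar

/-- The fan of comparison triangles with apex `0` over the chain `1, …, N + 1`, made convex by
enlarging the distances from the apex, does not decrease distances. -/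
theorem IsBoxForm.exists_fan {D : ℕ → ℕ → ℝ} (hD : IsBoxForm D) (hpos : ∀ i j, i ≠ j → 0 < D i j)
    (htri : ∀ i j k, i ≠ j → j ≠ k → i ≠ k → √(D i k) < √(D i j) + √(D j k)) (N : ℕ) :
    ∃ ρ θ : ℕ → ℝ, (∀ k, 0 < ρ k) ∧ Monotone θ ∧ ρ 0 ^ 2 = D 0 1 ∧ ρ N ^ 2 = D 0 (N + 1) ∧
      (∀ k, D 0 (k + 1) ≤ ρ k ^ 2) ∧
      (∀ k < N, coneSq (ρ k) (θ k) (ρ (k + 1)) (θ (k + 1)) = D (k + 1) (k + 2)) ∧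
      ∀ j l, j < l → l ≤ N → D (j + 1) (l + 1) ≤ coneSq (ρ j) (θ j) (ρ l) (θ l) := by
  have hsq (i j : ℕ) (h : i ≠ j) : √(D i j) ^ 2 = D i j := Real.sq_sqrt (hpos i j h).le
  obtain ⟨x, hx0⟩ : ∃ x : ℕ → ℝ, ∀ k, x k = ∑ i ∈ Finset.range k, √(D (i + 1) (i + 2)) :=
    ⟨_, fun _ => rfl⟩
  have hxs (k : ℕ) : x (k + 1) - x k = √(D (k + 1) (k + 2)) := by
    rw [hx0, hx0, Finset.sum_range_succ]; ring
  have hx (k : ℕ) : x k < x (k + 1) := by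
    rw [← sub_pos, hxs]; exact Real.sqrt_pos.2 (hpos _ _ (by omega))
  have hmono : StrictMono x := strictMono_nat_of_lt_succ hx
  have hdx (a b : ℕ) (hab : a < b) : √(D (a + 1) (b + 1)) ≤ x b - x a := by
    induction b, hab using Nat.le_induction with
    | base => exact (hxs a).ge
    | succ b hab ih =>
      have h1 := htri (a + 1) (b + 1) (b + 1 + 1) (by omega) (by omega) (by omega)
      have h2 := hxs b
      linarith
  have hr (k : ℕ) : 0 < √(D 0 (k + 1)) := Real.sqrt_pos.2 (hpos _ _ (by omega))
  obtain ⟨ρ, hrρ, hρ0, hρN, hρtri, hρconv, hρlin⟩ :=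
    exists_convex_radii (r := fun k => √(D 0 (k + 1))) hx hr (by
      intro a b hab
      have h1 := htri 0 (a + 1) (b + 1) (by omega) (by omega) (by omega)
      have h2 := htri 0 (b + 1) (a + 1) (by omega) (by omega) (by omega)
      rw [hD.symm (b + 1)] at h2
      have h3 := hdx a b hab
      constructor <;> linarith) N
  have hρ (k : ℕ) : 0 < ρ k := (hr k).trans_le (hrρ k)
  have hDρ (k : ℕ) : D 0 (k + 1) ≤ ρ k ^ 2 := by
    rw [← hsq 0 (k + 1) (by omega)]
    exact pow_le_pow_left₀ (hr k).le (hrρ k) 2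
  have hang (k : ℕ) (hk : k < N) := exists_angle (hρ k) (hρ (k + 1)) (hρtri k hk) (by
    have h1 := htri (k + 1) 0 (k + 2) (by omega) (by omega) (by omega)
    rw [hD.symm (k + 1) 0] at h1
    have h2 := hxs k
    have h3 := hrρ k
    have h4 : √(D 0 (k + 2)) ≤ ρ (k + 1) := hrρ (k + 1)
    linarith)
  obtain ⟨θ, hθ0⟩ : ∃ θ : ℕ → ℝ, ∀ k, θ k = ∑ i ∈ Finset.range k, Real.arccos
      ((ρ i ^ 2 + ρ (i + 1) ^ 2 - (x (i + 1) - x i) ^ 2) / (2 * ρ i * ρ (i + 1))) :=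
    ⟨_, fun _ => rfl⟩
  have hθs (k : ℕ) : Real.arccos ((ρ k ^ 2 + ρ (k + 1) ^ 2 - (x (k + 1) - x k) ^ 2)
      / (2 * ρ k * ρ (k + 1))) = θ (k + 1) - θ k := by
    rw [hθ0, hθ0, Finset.sum_range_succ]; ring
  have hθm : Monotone θ := monotone_nat_of_le_succ fun k => by
    rw [← sub_nonneg, ← hθs]; exact Real.arccos_nonneg _
  simp only [hθs] at hang
  have hθlt (j l : ℕ) (hjl : j < l) (hl : l ≤ N) : θ j < θ l :=
    lt_of_lt_of_le (sub_pos.1 (hang j (by omega)).1) (hθm hjl)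
  have habs (j l : ℕ) (hjl : j ≤ l) : |θ j - θ l| = θ l - θ j := by
    rw [abs_sub_comm, abs_of_nonneg (sub_nonneg.2 (hθm hjl))]
  have hedge (k : ℕ) (hk : k < N) :
      coneSq (ρ k) (θ k) (ρ (k + 1)) (θ (k + 1)) = (x (k + 1) - x k) ^ 2 := by
    rw [coneSq, coneCos_of_abs_le (by rw [habs k _ (by omega)]; exact (hang k hk).2.1.le),
      ← Real.cos_neg, neg_sub]
    exact (hang k hk).2.2
  obtain ⟨X, hX⟩ : ∃ X : ℕ → ℝ, X = fun i => ρ i * Real.cos (θ i) := ⟨_, rfl⟩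
  obtain ⟨Y, hY⟩ : ∃ Y : ℕ → ℝ, Y = fun i => ρ i * Real.sin (θ i) := ⟨_, rfl⟩
  have hXY (k : ℕ) : X k ^ 2 + Y k ^ 2 = ρ k ^ 2 := by rw [hX, hY]; exact polar_sq_add_sq ρ θ k
  have hplane (j l : ℕ) (hjl : j ≤ l) (h : θ l - θ j ≤ Real.pi) :
      planeSq X Y j l = coneSq (ρ j) (θ j) (ρ l) (θ l) := by
    rw [hX, hY]; exact planeSq_polar (by rwa [habs j l hjl])
  have harea (j l : ℕ) (hjl : j < l) (hl : l ≤ N) (h : θ l - θ j < Real.pi) :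
      0 < areaForm X Y j l := by
    rw [hX, hY]; exact areaForm_polar_pos hρ (hθlt j l hjl hl) h
  have hpe (k : ℕ) (hk : k < N) : planeSq X Y k (k + 1) = (x (k + 1) - x k) ^ 2 := by
    rw [hplane k (k + 1) (by omega) (hang k hk).2.1.le, hedge k hk]
  have hloc (k : ℕ) (hk : k + 2 ≤ N) :
      areaForm X Y k (k + 2) ≤ areaForm X Y k (k + 1) + areaForm X Y (k + 1) (k + 2) := by
    refine areaForm_add_nonneg (harea k (k + 1) (by omega) (by omega) (hang k (by omega)).2.1)
      (harea (k + 1) (k + 2) (by omega) hk (hang (k + 1) (by omega)).2.1) (sub_pos.2 (hx k))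
      (sub_pos.2 (hx (k + 1))) (hpe k (by omega)) (hpe (k + 1) (by omega)) ?_
    rw [hXY, hXY, hXY]
    have := hρconv k hk
    have e : k + 1 + 1 = k + 2 := rfl
    rw [e]
    linarith
  -- Away from contact the developed chain is a straight segment, and its angle from the apex stays
  -- below `π`.
  have hstraight (j l : ℕ) (hjl : j < l) (hl : l ≤ N)
      (h : ∀ i, j < i → i < l → √(D 0 (i + 1)) ≠ ρ i) :
      θ l - θ j < Real.pi ∧ planeSq X Y j l = (x l - x j) ^ 2 := by
    induction l, hjl using Nat.le_induction with
    | base => exact ⟨(hang j hl).2.1, hpe j hl⟩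
    | succ l hjl ih =>
      obtain ⟨h1, h2⟩ := ih (by omega) fun i hi hil => h i hi (by omega)
      have a1 := harea j l hjl (by omega) h1
      have a2 := harea l (l + 1) (by omega) hl (hang l hl).2.1
      obtain ⟨h3, h4⟩ := areaForm_add_eq a1 a2 (sub_pos.2 (hmono hjl)) (sub_pos.2 (hx l)) h2
        (hpe l hl) (by
          rw [hXY, hXY, hXY]
          linarith [hρlin j (l + 1) hl h l hjl (by omega)])
      refine ⟨?_, by rw [h4]; ring⟩
      -- An angle in `[π, 2π)` would have nonpositive sine, against the positive area `h5`.
      by_contra! hge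
      have h5 : 0 < areaForm X Y j (l + 1) := by rw [h3]; positivity
      rw [hX, hY, areaForm_polar] at h5
      have h6 := pos_of_mul_pos_right h5 (mul_pos (hρ j) (hρ (l + 1))).le
      have h7 : 0 ≤ Real.sin (θ (l + 1) - θ j - Real.pi) :=
        Real.sin_nonneg_of_nonneg_of_le_pi (by linarith) (by linarith [(hang l hl).2.1])
      rw [Real.sin_sub_pi] at h7
      linarith
  refine ⟨ρ, θ, hρ, hθm, by rw [hρ0, hsq 0 1 (by omega)], by rw [hρN, hsq 0 (N + 1) (by omega)],
    hDρ, fun k hk => by rw [hedge k hk, hxs, hsq _ _ (by omega)], fun j l hjl hl => ?_⟩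
  obtain ⟨n, hn⟩ : ∃ n, l - j ≤ n := ⟨_, le_rfl⟩
  induction n generalizing j l with
  | zero => omega
  | succ n ih =>
    -- Three cases: the cone geodesic passes through the apex; a contact index `k` lies between, so
    -- quadrilateral comparison applies with an exact diagonal; or the chain is straight and as long
    -- as its edges.
    rcases le_or_gt Real.pi (θ l - θ j) with hge | hlt
    · rw [coneSq_of_pi_le (by rwa [habs j l hjl.le]), ← hsq _ _ (by omega)]
      have h1 := htri (j + 1) 0 (l + 1) (by omega) (by omega) (by omega)
      rw [hD.symm (j + 1) 0] at h1
      exact pow_le_pow_left₀ (Real.sqrt_nonneg _) (by linarith [hrρ j, hrρ l]) 2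
    rw [← hplane j l hjl.le hlt.le]
    by_cases hc : ∃ k, j < k ∧ k < l ∧ √(D 0 (k + 1)) = ρ k
    · obtain ⟨k, hjk, hkl, hk⟩ := hc
      have t1 : θ k - θ j < Real.pi := by linarith [hθm hkl.le]
      have t2 : θ l - θ k < Real.pi := by linarith [hθm hjk.le]
      refine hD.le_planeSq (x := 0) (z := k + 1) (harea j k hjk (by omega) t1)
        (harea k l hkl hl t2) (harea j l hjl hl hlt).le ?_ ?_ ?_ ?_ ?_ ?_
      · refine areaForm_le_of_local (a := j) (b := l) (fun a b ha hab hb => ?_)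
          (fun k _ hkl => hloc k (by omega)) le_rfl hjk hkl le_rfl
        exact harea a b hab (by omega) (by linarith [hθm ha, hθm hb])
      · rw [hXY]; exact hDρ j
      · rw [hXY, ← hk, hsq _ _ (by omega)]
      · rw [hXY]; exact hDρ l
      · rw [hplane j k hjk.le t1.le]; exact ih j k hjk (by omega) (by omega)
      · rw [hplane k l hkl.le t2.le]; exact ih k l hkl hl (by omega)
    · push Not at hc
      rw [(hstraight j l hjl hl hc).2, ← hsq _ _ (by omega)]
      exact pow_le_pow_left₀ (Real.sqrt_nonneg _) (hdx j l hjl) 2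

/-! ### Planar majorants of polygons -/

theorem planeSq_comm (X Y : ℕ → ℝ) (j k : ℕ) : planeSq X Y j k = planeSq X Y k j := by
  rw [planeSq, planeSq]; ring

theorem planeSq_self (X Y : ℕ → ℝ) (j : ℕ) : planeSq X Y j j = 0 := by
  rw [planeSq]; ring

/-- There is a closed polygon in the plane with vertices `0, …, N` whose edges have the squared
lengths prescribed by `D`, and whose diagonals are at least as long as prescribed. -/
def HasPlanarMajorant (N : ℕ) (D : ℕ → ℕ → ℝ) : Prop :=
  ∃ X Y : ℕ → ℝ, (∀ k < N, planeSq X Y k (k + 1) = D k (k + 1)) ∧ planeSq X Y N 0 = D N 0 ∧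
    ∀ j l, j ≤ N → l ≤ N → D j l ≤ planeSq X Y j l

theorem IsBoxForm.hasPlanarMajorant_cons {D : ℕ → ℕ → ℝ} (hD : IsBoxForm D) {N : ℕ} (a b : ℝ)
    (X Y : ℕ → ℝ) (hedge : ∀ k < N, planeSq X Y k (k + 1) = D (k + 1) (k + 2))
    (h0 : (a - X 0) ^ 2 + (b - Y 0) ^ 2 = D 0 1)
    (hN : (a - X N) ^ 2 + (b - Y N) ^ 2 = D 0 (N + 1))
    (hapex : ∀ k ≤ N, D 0 (k + 1) ≤ (a - X k) ^ 2 + (b - Y k) ^ 2)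
    (hchain : ∀ j l, j < l → l ≤ N → D (j + 1) (l + 1) ≤ planeSq X Y j l) :
    HasPlanarMajorant (N + 1) D := by
  let X' : ℕ → ℝ := fun k => Nat.casesOn k a X
  let Y' : ℕ → ℝ := fun k => Nat.casesOn k b Y
  have e (j l : ℕ) : planeSq X' Y' (j + 1) (l + 1) = planeSq X Y j l := rfl
  have e0 (k : ℕ) : planeSq X' Y' 0 (k + 1) = (a - X k) ^ 2 + (b - Y k) ^ 2 := rfl
  have hlt (j l : ℕ) (hjl : j < l) (hl : l ≤ N + 1) : D j l ≤ planeSq X' Y' j l := by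
    obtain ⟨l, rfl⟩ : ∃ m, l = m + 1 := ⟨l - 1, by omega⟩
    cases j with
    | zero => rw [e0]; exact hapex l (by omega)
    | succ j => rw [e]; exact hchain j l (by omega) (by omega)
  refine ⟨X', Y', fun k hk => ?_, ?_, fun j l hj hl => ?_⟩
  · cases k with
    | zero => rw [e0]; exact h0
    | succ k => rw [e]; exact hedge k (by omega)
  · rw [planeSq_comm, e0, hN, hD.symm]
  · rcases lt_trichotomy j l with h | h | h
    · exact hlt j l h hl
    · rw [h, hD.self, planeSq_self]
    · rw [hD.symm, planeSq_comm]; exact hlt l j h hj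

theorem IsBoxForm.hasPlanarMajorant_succ {D : ℕ → ℕ → ℝ} (hD : IsBoxForm D)
    (hpos : ∀ i j, i ≠ j → 0 < D i j)
    (htri : ∀ i j k, i ≠ j → j ≠ k → i ≠ k → √(D i k) < √(D i j) + √(D j k)) {N : ℕ}
    (ih : ∀ D' : ℕ → ℕ → ℝ, IsBoxForm D' → HasPlanarMajorant N D') :
    HasPlanarMajorant (N + 1) D := by
  obtain ⟨ρ, θ, hρ, hθ, h0, hN, hapex, hedge, hchain⟩ := hD.exists_fan hpos htri N
  have habs (j l : ℕ) (hjl : j ≤ l) : |θ j - θ l| = θ l - θ j := by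
    rw [abs_sub_comm, abs_of_nonneg (sub_nonneg.2 (hθ hjl))]
  rcases le_or_gt (θ N - θ 0) Real.pi with hle | hgt
  · have hplane (j l : ℕ) (hjl : j < l) (hl : l ≤ N) := planeSq_polar (ρ := ρ) (θ := θ) (j := j)
      (k := l) (by rw [habs j l hjl.le]; linarith [hθ (Nat.zero_le j), hθ hl])
    have hnorm (k : ℕ) : (0 - ρ k * Real.cos (θ k)) ^ 2 + (0 - ρ k * Real.sin (θ k)) ^ 2
        = ρ k ^ 2 := by rw [zero_sub, zero_sub, neg_sq, neg_sq]; exact polar_sq_add_sq ρ θ k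
    refine hD.hasPlanarMajorant_cons 0 0 (fun i => ρ i * Real.cos (θ i))
      (fun i => ρ i * Real.sin (θ i)) (fun k hk => ?_) ?_ ?_ (fun k _ => ?_) fun j l hjl hl => ?_
    · rw [hplane k (k + 1) (by omega) hk, hedge k hk]
    · rw [hnorm, h0]
    · rw [hnorm, hN]
    · rw [hnorm]; exact hapex k
    · rw [hplane j l hjl hl]; exact hchain j l hjl hl
  -- The closing edge has length `ρ 0 + ρ N`, since the angle exceeds `π`; the apex goes at distance
  -- `ρ 0` from its start.
  · obtain ⟨X, Y, hXYe, hXYN, hXY⟩ := ih _ (isBoxForm_coneSq (fun k => (hρ k).le) θ)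
    have hL : 0 < ρ 0 + ρ N := add_pos (hρ 0) (hρ N)
    beta_reduce at hXYe hXYN hXY
    rw [coneSq_comm, coneSq_of_pi_le (by rw [habs 0 N (Nat.zero_le N)]; exact hgt.le)] at hXYN
    have stewart (u v : ℝ) : ((ρ N * X 0 + ρ 0 * X N) / (ρ 0 + ρ N) - u) ^ 2
        + ((ρ N * Y 0 + ρ 0 * Y N) / (ρ 0 + ρ N) - v) ^ 2
        = (ρ N * ((X 0 - u) ^ 2 + (Y 0 - v) ^ 2) + ρ 0 * ((X N - u) ^ 2 + (Y N - v) ^ 2))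
          / (ρ 0 + ρ N) - ρ 0 * ρ N := by
      rw [planeSq] at hXYN
      field_simp
      linear_combination -ρ 0 * ρ N * hXYN
    refine hD.hasPlanarMajorant_cons ((ρ N * X 0 + ρ 0 * X N) / (ρ 0 + ρ N))
      ((ρ N * Y 0 + ρ 0 * Y N) / (ρ 0 + ρ N)) X Y (fun k hk => ?_) ?_ ?_ (fun k hk => ?_)
      fun j l hjl hl => ?_
    · rw [hXYe k hk, hedge k hk]
    · rw [stewart, ← h0]
      change (ρ N * planeSq X Y 0 0 + ρ 0 * planeSq X Y N 0) / _ - _ = _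
      rw [hXYN, planeSq_self]
      field_simp
      ring
    · rw [stewart, ← hN]
      change (ρ N * planeSq X Y 0 N + ρ 0 * planeSq X Y N N) / _ - _ = _
      rw [planeSq_comm X Y 0, hXYN, planeSq_self]
      field_simp
      ring
    · refine (hapex k).trans ?_
      rw [stewart]
      change _ ≤ (ρ N * planeSq X Y 0 k + ρ 0 * planeSq X Y N k) / _ - _
      have a1 := mul_le_mul_of_nonneg_left (hXY 0 k (Nat.zero_le N) hk) (hρ N).le
      have a2 := mul_le_mul_of_nonneg_left (hXY N k le_rfl hk) (hρ 0).le
      rw [coneSq] at a1 a2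
      -- The angles from `θ k` to the two ends add up to more than `π`; this is why the apex moves
      -- no closer to vertex `k`.
      have hc : coneCos (θ 0 - θ k) + coneCos (θ N - θ k) ≤ 0 := by
        apply coneCos_add_nonpos
        rw [habs 0 k (Nat.zero_le k), abs_of_nonneg (sub_nonneg.2 (hθ hk))]
        linarith
      have hc' := mul_nonneg (mul_pos (mul_pos (hρ 0) (hρ N)) (hρ k)).le (neg_nonneg.2 hc)
      rw [le_sub_iff_add_le, le_div_iff₀ hL]
      linarith
    · exact (hchain j l hjl hl).trans (hXY j l (by omega) hl)

/-! ### Degenerate forms: perturbation and limits -/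

theorem IsBoxForm.nonneg {ι : Type*} {D : ι → ι → ℝ} (hD : IsBoxForm D) (x y : ι) : 0 ≤ D x y := by
  simpa using hD.box 0 (by simp) 0 (by simp) x y y y

theorem IsBoxForm.triangle {ι : Type*} {D : ι → ι → ℝ} (hD : IsBoxForm D) (x y z : ι) {t : ℝ}
    (ht : t ∈ Set.Icc (0 : ℝ) 1) : t * (1 - t) * D x z ≤ (1 - t) * D x y + t * D y z := by
  have := hD.box t ht 0 (by simp) x y z y
  simp only [hD.self] at this
  linarith

theorem IsBoxForm.le_of_eq_zero {ι : Type*} {D : ι → ι → ℝ} (hD : IsBoxForm D) {x y : ι}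
    (h : D x y = 0) (z : ι) : D x z ≤ D y z := by
  by_contra! hlt
  have hy := hD.nonneg y z
  have hx : 0 < D x z := hy.trans_lt hlt
  have ht : 0 < (D x z - D y z) / (2 * D x z) := div_pos (by linarith) (by linarith)
  have key := hD.triangle x y z (t := (D x z - D y z) / (2 * D x z))
    ⟨ht.le, by rw [div_le_one (by linarith)]; linarith⟩
  rw [h, mul_zero, zero_add, mul_assoc] at key
  have := le_of_mul_le_mul_left key ht
  have e : (1 - (D x z - D y z) / (2 * D x z)) * D x z = (D x z + D y z) / 2 := by
    field_simp; ring
  linarith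

/-- The degenerate `⊠`-inequality `triangle` with `t = a / (a + b)` becomes `D x z ≤ (a + b) ^ 2`.
-/
theorem IsBoxForm.sqrt_le_add {ι : Type*} {D : ι → ι → ℝ} (hD : IsBoxForm D) (x y z : ι) :
    √(D x z) ≤ √(D x y) + √(D y z) := by
  rcases (hD.nonneg x y).eq_or_lt with h1 | h1
  · rw [← h1, Real.sqrt_zero, zero_add]
    exact Real.sqrt_le_sqrt (hD.le_of_eq_zero h1.symm z)
  rcases (hD.nonneg y z).eq_or_lt with h2 | h2
  · rw [← h2, Real.sqrt_zero, add_zero, hD.symm x z, hD.symm x y]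
    exact Real.sqrt_le_sqrt (hD.le_of_eq_zero (by rw [hD.symm, ← h2]) x)
  have ha2 := Real.sq_sqrt h1.le
  have hb2 := Real.sq_sqrt h2.le
  have ha := Real.sqrt_pos.2 h1
  have hb := Real.sqrt_pos.2 h2
  set a := √(D x y)
  set b := √(D y z)
  have key := hD.triangle x y z (t := a / (a + b))
    ⟨by positivity, by rw [div_le_one (by positivity)]; linarith⟩
  rw [← ha2, ← hb2] at key
  have e1 : a / (a + b) * (1 - a / (a + b)) * D x z = a * b * (D x z / (a + b) ^ 2) := by
    field_simp; ring
  have e2 : (1 - a / (a + b)) * a ^ 2 + a / (a + b) * b ^ 2 = a * b * 1 := by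
    field_simp; ring
  rw [e1, e2] at key
  have := le_of_mul_le_mul_left key (by positivity)
  rw [div_le_one (by positivity)] at this
  exact Real.sqrt_le_iff.2 ⟨by positivity, this⟩

/-- These are the squared distances of a regular simplex; adding them makes `D` positive off the
diagonal and its triangle inequalities strict. -/
theorem isBoxForm_discrete {ι : Type*} [DecidableEq ι] {ε : ℝ} (hε : 0 ≤ ε) :
    IsBoxForm fun i j : ι => if i = j then 0 else ε where
  self x := by simp
  symm x y := by simp [eq_comm]
  box t ht s hs x y z w := by
    obtain ⟨ht0, ht1⟩ := ht
    obtain ⟨hs0, hs1⟩ := hs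
    have h1 := mul_nonneg hε (sq_nonneg (t - s))
    have h2 := mul_nonneg hε (sq_nonneg (t + s - 1))
    have h3 := mul_nonneg hε (mul_nonneg ht0 (sub_nonneg.2 ht1))
    have h4 := mul_nonneg hε (mul_nonneg hs0 (sub_nonneg.2 hs1))
    have h5 := mul_nonneg hε (mul_nonneg ht0 hs0)
    have h6 := mul_nonneg hε (mul_nonneg (sub_nonneg.2 ht1) hs0)
    have h7 := mul_nonneg hε (mul_nonneg ht0 (sub_nonneg.2 hs1))
    have h8 := mul_nonneg hε (mul_nonneg (sub_nonneg.2 ht1) (sub_nonneg.2 hs1))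
    have h9 := mul_nonneg hε (sq_nonneg t)
    have h10 := mul_nonneg hε (sq_nonneg s)
    have h11 := mul_nonneg hε (sq_nonneg (1 - t))
    have h12 := mul_nonneg hε (sq_nonneg (1 - s))
    split_ifs <;> first | (exfalso; grind) | nlinarith

theorem IsBoxForm.add {ι : Type*} {D E : ι → ι → ℝ} (hD : IsBoxForm D) (hE : IsBoxForm E) :
    IsBoxForm fun i j => D i j + E i j where
  self x := by simp [hD.self, hE.self]
  symm x y := by rw [hD.symm, hE.symm]
  box t ht s hs x y z w := by linarith [hD.box t ht s hs x y z w, hE.box t ht s hs x y z w]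

/-- Edges bound the polygons once vertex `0` is translated to the origin, so a subsequence
converges. -/
theorem IsBoxForm.hasPlanarMajorant_of_forall {D : ℕ → ℕ → ℝ} (hD : IsBoxForm D) {N : ℕ}
    (h : ∀ ε > 0, HasPlanarMajorant N fun i j => D i j + if i = j then 0 else ε) :
    HasPlanarMajorant N D := by
  choose! X Y hedge hN hall using h
  obtain ⟨ε, hε⟩ : ∃ ε : ℕ → ℝ, ε = fun m : ℕ => 1 / ((m : ℝ) + 1) := ⟨_, rfl⟩
  have hεpos (m : ℕ) : 0 < ε m := by rw [hε]; exact Nat.one_div_pos_of_nat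
  have hεone (m : ℕ) : ε m ≤ 1 := by
    rw [hε, div_le_one (by positivity)]
    linarith [(Nat.cast_nonneg m : (0 : ℝ) ≤ m)]
  have hεlim : Filter.Tendsto ε Filter.atTop (nhds 0) := by
    rw [hε]; exact tendsto_one_div_add_atTop_nhds_zero_nat
  obtain ⟨B, hB1, hB⟩ : ∃ B : ℝ, 1 ≤ B ∧ ∀ k < N, D k (k + 1) + 1 ≤ B ^ 2 := by
    have h0 : 0 ≤ ∑ k ∈ Finset.range N, D k (k + 1) := Finset.sum_nonneg fun k _ => hD.nonneg _ _
    refine ⟨1 + ∑ k ∈ Finset.range N, D k (k + 1), by linarith, fun k hk => ?_⟩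
    have := Finset.single_le_sum (f := fun k => D k (k + 1)) (fun k _ => hD.nonneg _ _)
      (Finset.mem_range.2 hk)
    nlinarith
  have hbound (m k : ℕ) (hk : k ≤ N) : |X (ε m) k - X (ε m) 0| ≤ k * B ∧
      |Y (ε m) k - Y (ε m) 0| ≤ k * B := by
    induction k with
    | zero => simp
    | succ k ih =>
      obtain ⟨i1, i2⟩ := ih (by omega)
      have e := hedge (ε m) (hεpos m) k hk
      simp only [planeSq] at e
      rw [if_neg (by omega)] at e
      have e' : (X (ε m) k - X (ε m) (k + 1)) ^ 2 + (Y (ε m) k - Y (ε m) (k + 1)) ^ 2 ≤ B ^ 2 := by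
        rw [e]; linarith [hB k hk, hεone m]
      have b1 : |X (ε m) k - X (ε m) (k + 1)| ≤ B :=
        abs_le_of_sq_le_sq (by linarith [sq_nonneg (Y (ε m) k - Y (ε m) (k + 1))]) (by linarith)
      have b2 : |Y (ε m) k - Y (ε m) (k + 1)| ≤ B :=
        abs_le_of_sq_le_sq (by linarith [sq_nonneg (X (ε m) k - X (ε m) (k + 1))]) (by linarith)
      rw [abs_le] at i1 i2 b1 b2 ⊢
      rw [abs_le]
      push_cast
      refine ⟨⟨?_, ?_⟩, ?_, ?_⟩ <;> linarith
  obtain ⟨G, hG⟩ : ∃ G : ℕ → ℕ → ℝ × ℝ, ∀ m k, G m k =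
      if k ≤ N then (X (ε m) k - X (ε m) 0, Y (ε m) k - Y (ε m) 0) else 0 := ⟨_, fun _ _ => rfl⟩
  have hGmem (m : ℕ) : G m ∈ Set.univ.pi fun k : ℕ =>
      Set.Icc (-(k * B)) (k * B) ×ˢ Set.Icc (-(k * B)) (k * B) := by
    intro k _
    rw [hG]
    have hkB : (0 : ℝ) ≤ k * B := by positivity
    split_ifs with hk
    · exact ⟨abs_le.1 (hbound m k hk).1, abs_le.1 (hbound m k hk).2⟩
    · exact ⟨⟨neg_nonpos.2 hkB, hkB⟩, neg_nonpos.2 hkB, hkB⟩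
  obtain ⟨g, -, φ, hφ, hlim⟩ := (isCompact_univ_pi fun k : ℕ =>
    (isCompact_Icc (a := -(k * B)) (b := k * B)).prod
      (isCompact_Icc (a := -(k * B)) (b := k * B))).tendsto_subseq hGmem
  rw [tendsto_pi_nhds] at hlim
  have hsq (j l : ℕ) (hj : j ≤ N) (hl : l ≤ N) :
      Filter.Tendsto (fun m => planeSq (X (ε (φ m))) (Y (ε (φ m))) j l) Filter.atTop
        (nhds (planeSq (fun k => (g k).1) (fun k => (g k).2) j l)) := by
    have h1 := ((hlim j).fst_nhds.sub (hlim l).fst_nhds).pow 2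
    have h2 := ((hlim j).snd_nhds.sub (hlim l).snd_nhds).pow 2
    refine (h1.add h2).congr fun m => ?_
    simp only [Function.comp_apply, hG, if_pos hj, if_pos hl, planeSq]
    ring
  have hDlim (j l : ℕ) : Filter.Tendsto (fun m => D j l + if j = l then 0 else ε (φ m))
      Filter.atTop (nhds (D j l)) := by
    split_ifs
    · simp
    · simpa using (hεlim.comp hφ.tendsto_atTop).const_add (D j l)
  refine ⟨fun k => (g k).1, fun k => (g k).2, fun k hk => ?_, ?_, fun j l hj hl => ?_⟩
  · refine tendsto_nhds_unique ((hsq k (k + 1) hk.le hk).congr fun m => ?_) (hDlim k (k + 1))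
    exact hedge _ (hεpos _) k hk
  · refine tendsto_nhds_unique ((hsq N 0 le_rfl (Nat.zero_le N)).congr fun m => ?_) (hDlim N 0)
    exact hN _ (hεpos _)
  · exact le_of_tendsto_of_tendsto' (hDlim j l) (hsq j l hj hl)
      fun m => hall _ (hεpos _) j l hj hl

theorem sqrt_add_lt {a b c ε : ℝ} (ha : 0 ≤ a) (hb : 0 ≤ b) (hc : 0 ≤ c) (hε : 0 < ε)
    (h : √c ≤ √a + √b) : √(c + ε) < √(a + ε) + √(b + ε) := by
  have ha2 := Real.sq_sqrt ha
  have hb2 := Real.sq_sqrt hb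
  have hc2 := Real.sq_sqrt hc
  have hae2 := Real.sq_sqrt (by positivity : 0 ≤ a + ε)
  have hbe2 := Real.sq_sqrt (by positivity : 0 ≤ b + ε)
  rw [Real.sqrt_lt' (by positivity)]
  have h1 : √a * √b ≤ √(a + ε) * √(b + ε) :=
    mul_le_mul (Real.sqrt_le_sqrt (by linarith)) (Real.sqrt_le_sqrt (by linarith))
      (Real.sqrt_nonneg _) (Real.sqrt_nonneg _)
  have h2 := pow_le_pow_left₀ (Real.sqrt_nonneg c) h 2
  nlinarith

/-- Every closed polygon whose squared distances satisfy the `⊠`-inequalities is majorized by a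
closed polygon in the plane. -/
theorem IsBoxForm.hasPlanarMajorant {D : ℕ → ℕ → ℝ} (hD : IsBoxForm D) (N : ℕ) :
    HasPlanarMajorant N D := by
  induction N generalizing D with
  | zero =>
    refine ⟨0, 0, by omega, by rw [planeSq_self, hD.self], fun j l hj hl => ?_⟩
    obtain rfl : j = 0 := by omega
    obtain rfl : l = 0 := by omega
    rw [planeSq_self, hD.self]
  | succ N ih =>
    refine hD.hasPlanarMajorant_of_forall fun ε hε => ?_
    refine (hD.add (isBoxForm_discrete hε.le)).hasPlanarMajorant_succ (fun i j hij => ?_)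
      (fun i j k hij hjk hik => ?_) fun D' hD' => ih hD'
    · rw [if_neg hij]
      linarith [hD.nonneg i j]
    · rw [if_neg hij, if_neg hjk, if_neg hik]
      exact sqrt_add_lt (hD.nonneg _ _) (hD.nonneg _ _) (hD.nonneg _ _) hε (hD.sqrt_le_add i j k)

/-! ### The conditions `Cycl_n(0)` and the corollary -/

theorem SatisfiesBoxtimesInequalities.isCyclZero {X : Type*} [MetricSpace X]
    (h : SatisfiesBoxtimesInequalities X) (n : ℕ) [NeZero n] (hn : 2 ≤ n) : IsCyclZero n X := by
  intro f
  obtain ⟨N, rfl⟩ : ∃ N, n = N + 1 := ⟨n - 1, by omega⟩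
  -- The cycle is pulled back periodically to `ℕ`, so `D` vanishes at distinct indices; the
  -- perturbation already allows for this.
  obtain ⟨U, V, hedge, hN, hall⟩ :=
    (h.isBoxForm fun k : ℕ => f (k : ZMod (N + 1))).hasPlanarMajorant N
  have hdist (i j : ZMod (N + 1)) :
      dist (!₂[U i.val, V i.val] : EuclideanSpace ℝ (Fin 2)) !₂[U j.val, V j.val] ^ 2
        = planeSq U V i.val j.val := by
    simp [EuclideanSpace.dist_sq_eq, Fin.sum_univ_two, Real.dist_eq, sq_abs, planeSq]
  have hval (i : ZMod (N + 1)) : i.val ≤ N := Nat.lt_succ_iff.1 (ZMod.val_lt i)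
  refine ⟨fun i => !₂[U i.val, V i.val], fun i => ?_, fun i j _ _ => ?_⟩
  · refine (pow_le_pow_iff_left₀ dist_nonneg dist_nonneg two_ne_zero).1 ?_
    rw [hdist]
    rcases (hval i).lt_or_eq with hi | hi
    · have e : (i + 1).val = i.val + 1 := by
        rw [ZMod.val_add_of_lt] <;> rw [ZMod.val_one'' (by omega)]
        omega
      rw [e, hedge _ hi]
      simp
    · have e : i + 1 = 0 := by
        rw [← ZMod.natCast_zmod_val i, hi]
        exact_mod_cast ZMod.natCast_self (N + 1)
      have e2 : i = (N : ZMod (N + 1)) := by rw [← ZMod.natCast_zmod_val i, hi]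
      rw [e, ZMod.val_zero, hi, hN]
      simp [← e2]
  · refine (pow_le_pow_iff_left₀ dist_nonneg dist_nonneg two_ne_zero).1 ?_
    rw [hdist]
    simpa using hall i.val j.val (hval i) (hval j)

theorem mainTheorem8 {X : Type*} [MetricSpace X] :
    (SatisfiesBoxtimesInequalities X →
      ∀ (n : ℕ) [NeZero n], 4 ≤ n → IsCyclZero n X ∧ SatisfiesWirInequalities n X) ∧
    (IsCyclZero 4 X →
      ∀ (n : ℕ) [NeZero n], 4 ≤ n → SatisfiesWirInequalities n X) :=
  ⟨fun h n _ hn => ⟨h.isCyclZero n (by omega), h.satisfiesWirInequalities n hn⟩,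
    fun h n _ hn => h.satisfiesBoxtimesInequalities.satisfiesWirInequalities n hn⟩
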